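/- All graphs are finite and simple, $e(G)$ is the number of edges of $G$, $\alpha(G)$ is its independence number (the largest size of an independent set), and $\log$ is the natural logarithm. For a graph $H$, an integer $n\ge 0$ and a real number $m$, let $\mathrm{RT}(n,H,m)$ be the maximum number of edges of an $n$-vertex graph $G$ that contains no copy of $H$ as a subgraph and satisfies $\alpha(G)\le m$ (with the value $0$ if there is no such graph). **Theorem 1.3.** (i) For every $\gamma>0$ there exists $\delta>0$ such that, for every $n$, every $n$-vertex $K_8$-free graph $G$ with $\alpha(G)\le \delta\sqrt{n\log n}$ satisfies $e(G)\le \frac{n^2}{4}+\gamma n^2$. (ii) Moreover, $\mathrm{RT}(n,K_8,o(\sqrt{n\log n}))=\frac{n^2}{4}+o(n^2)$, in the following sense: for every $\varepsilon>0$ there is $\delta_0>0$ such that for every $\delta\in(0,\delta_0]$ there is $n_0$ such that for all $n\ge n_0$, $$\left|\mathrm{RT}\bigl(n,K_8,\delta\sqrt{n\log n}\bigr)-\frac{n^2}{4}\right|\le \varepsilon n^2 .$$ -/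

import Mathlib

open Filter

/-- The Ramsey–Turán number `RT(n, H, m)`: the maximum number of edges of an `n`-vertex graph
that contains no copy of `H` (as a not necessarily induced subgraph) and has independence number
at most the real number `m`. The set below is bounded, so the supremum is a maximum whenever such
a graph exists; it is `0` when there is none. -/
noncomputable def ramseyTuran {W : Type*} (n : ℕ) (H : SimpleGraph W) (m : ℝ) : ℕ :=
  sSup {e : ℕ | ∃ G : SimpleGraph (Fin n),
    H.Free G ∧ (G.indepNum : ℝ) ≤ m ∧ G.edgeSet.ncard = e}

/-- `RT(n, H, o(f(n))) = c n² + o(n²)`: the edge density `RT(n, H, δ f(n)) / n²` tends to `c` as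
first `n → ∞` and then `δ → 0`. That is, for every `ε > 0`, for all sufficiently small `δ > 0`,
for all sufficiently large `n`, the number `RT(n, H, δ f(n))` differs from `c n²` by at
most `ε n²`. (Existence of the limit in `n` for a fixed `δ` is not part of the claim; equivalently,
both the lower and the upper limit in `n` tend to `c` as `δ → 0`.) -/
def RamseyTuranLittleO {W : Type*} (H : SimpleGraph W) (f : ℕ → ℝ) (c : ℝ) : Prop :=
  ∀ ε : ℝ, 0 < ε → ∃ δ₀ : ℝ, 0 < δ₀ ∧ ∀ δ : ℝ, 0 < δ → δ ≤ δ₀ →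
    ∀ᶠ n : ℕ in atTop,
      |(ramseyTuran n H (δ * f n) : ℝ) - c * (n : ℝ) ^ 2| ≤ ε * (n : ℝ) ^ 2

/-! Upper bound. Apply Szemerédi regularity and weight each pair of parts by its edge density,
keeping only regular pairs that are not sparse. Two configurations of parts force a `K₈`. (a) Four
pairwise positive parts: choose an edge in the first part with linearly many common neighbours in
each other part, restrict to those neighbours, and repeat. This gives `2 + 2 + 2 + 2` vertices
(`exists_isNClique_two_mul`). (b) A positive triangle with one pair denser than `7 / 10`: an edge in
the opposite part shrinks the dense pair to common neighbourhoods. A triangle of high-degree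
vertices on one side then keeps a positive fraction of the other side, since `3 · 0.31 < 1`, and a
second triangle is found there, giving `2 + 3 + 3` vertices (`exists_isNClique_eight`). Edges with
large common neighbourhoods come from dependent random choice, which needs only `α ≤ √(n log n)`.
Triangles in linear-sized sets come from the Ajtai–Komlós–Szemerédi bound, which needs `α ≤ δ √(n
log n)` with `δ` small. With (a) and (b) excluded, the weighted Turán bound `sum_weights_le` gives
average weight at most `1 / 2`, hence about `n² / 4` edges.

Lower bound. Put all edges between the two halves of a `K₄`-free graph with independence number
`O(√n)`. An 8-clique would have four vertices in one half. The `K₄`-free graph is a random graph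
minus a maximal family of edge-disjoint `K₄`s. -/

/-! ### Independent sets in triangle-free graphs -/

lemma two_mul_sum_card_powerset {α : Type*} [DecidableEq α] (X : Finset α) :
    2 * ∑ A ∈ X.powerset, (A.card : ℝ) = X.card * 2 ^ X.card := by
  have h : ∑ A ∈ X.powerset, (A.card : ℝ) = ∑ A ∈ X.powerset, ((X \ A).card : ℝ) := by
    refine Finset.sum_nbij' (fun A => X \ A) (fun A => X \ A) ?_ ?_ ?_ ?_ ?_
    · intro A _; simp
    · intro A _; simp
    · intro A hA; simpa using hA
    · intro A hA; simpa using hA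
    · intro A hA
      rw [Finset.sdiff_sdiff_eq_self (Finset.mem_powerset.1 hA)]
  rw [two_mul]
  nth_rw 2 [h]
  rw [← Finset.sum_add_distrib]
  rw [Finset.sum_congr rfl (g := fun _ => (X.card : ℝ))]
  · simp [mul_comm]
  · intro A hA
    have := Finset.card_sdiff_add_card_eq_card (Finset.mem_powerset.1 hA)
    rw [add_comm]
    exact_mod_cast this

/-- Compare `2 ^ x` with `√D`: below it, the term `D` alone dominates; above it, `x` is at least of
order `log D` and the second term dominates. -/
lemma two_pow_add_one_mul_log_le {D : ℝ} (hD : 1 ≤ D) (x : ℕ) :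
    ((2 : ℝ) ^ x + 1) * (Real.log D / 8) ≤ D + x * 2 ^ x / 2 := by
  have h0 : 0 ≤ Real.log D := Real.log_nonneg hD
  have hp : (1 : ℝ) ≤ 2 ^ x := one_le_pow₀ (by norm_num)
  have hs : 1 ≤ √D := by simpa using Real.sqrt_le_sqrt hD
  have hs2 : √D * √D = D := Real.mul_self_sqrt (by linarith)
  have hlog : Real.log D = 2 * Real.log √D := by
    rw [Real.log_sqrt (by linarith)]; ring
  rcases le_or_gt ((2 : ℝ) ^ x) √D with h | h
  · have h1 : Real.log √D ≤ √D := (Real.log_le_sub_one_of_pos (by linarith)).trans (by linarith)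
    have h2 : (2 : ℝ) ^ x + 1 ≤ 2 * √D := by linarith
    have : ((2 : ℝ) ^ x + 1) * (Real.log D / 8) ≤ (2 * √D) * (2 * √D / 8) := by
      apply mul_le_mul h2 _ (by positivity) (by positivity)
      linarith
    have h4 : (0 : ℝ) ≤ x * 2 ^ x / 2 := by positivity
    nlinarith
  · have h1 : Real.log √D ≤ x * Real.log 2 := by
      rw [← Real.log_pow]
      exact Real.log_le_log (by linarith) h.le
    have h2 := Real.log_two_lt_d9
    have hx : (0 : ℝ) ≤ x := Nat.cast_nonneg x
    have h3 : Real.log D ≤ 2 * x := by nlinarith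
    have : ((2 : ℝ) ^ x + 1) * (Real.log D / 8) ≤ (2 * 2 ^ x) * (2 * x / 8) := by
      apply mul_le_mul (by linarith) (by linarith) (by positivity) (by positivity)
    nlinarith

namespace SimpleGraph

variable {V : Type*} [Fintype V] [DecidableEq V] (G : SimpleGraph V) [DecidableRel G.Adj]

/-- The independent sets of a triangle-free graph that agree outside the closed neighbourhood
of `v`: either `v` is added, or an arbitrary set of available neighbours of `v`. -/
lemma filter_sdiff_closedNeighborhood_eq (hG : G.CliqueFree 3) (v : V) {s₀ : Finset V}
    (hs₀ : G.IsIndepSet s₀) {t : Finset V} (ht : s₀ \ insert v (G.neighborFinset v) = t) :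
    {s : Finset V | G.IsIndepSet s ∧ s \ insert v (G.neighborFinset v) = t} =
      insert (insert v t) ((({u ∈ G.neighborFinset v | ∀ w ∈ t, ¬ G.Adj u w} : Finset V).powerset.image
        (t ∪ ·) : Finset (Finset V)) : Set (Finset V)) := by
  have hN : ∀ u ∈ G.neighborFinset v, ∀ w ∈ G.neighborFinset v, ¬ G.Adj u w := by
    intro u hu w hw h
    exact isIndepSet_neighborSet_of_triangleFree G hG v (by simpa using hu) (by simpa using hw)
      h.ne h
  have htv : v ∉ t := by rw [← ht]; simp
  have htN : ∀ u ∈ t, ¬ G.Adj v u := by rw [← ht]; simp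
  have htI : ∀ u ∈ t, ∀ w ∈ t, ¬ G.Adj u w := by
    intro u hu w hw h
    rw [← ht, Finset.mem_sdiff] at hu hw
    exact hs₀ hu.1 hw.1 h.ne h
  ext s
  simp only [Set.mem_ofPred_eq, Set.mem_insert_iff, Finset.coe_image, Set.mem_image,
    Finset.mem_coe, Finset.mem_powerset]
  constructor
  · rintro ⟨hs, hst⟩
    by_cases hv : v ∈ s
    · left
      ext u
      rw [← hst]
      simp only [Finset.mem_insert, Finset.mem_sdiff, mem_neighborFinset]
      constructor
      · intro hu
        by_cases huv : u = v
        · exact Or.inl huv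
        · exact Or.inr ⟨hu, by rintro (h | h); exacts [huv h, hs hv hu (Ne.symm huv) h]⟩
      · rintro (rfl | h)
        exacts [hv, h.1]
    · right
      refine ⟨s ∩ G.neighborFinset v, ?_, ?_⟩
      · intro u hu
        rw [Finset.mem_inter] at hu
        rw [Finset.mem_filter]
        refine ⟨hu.2, fun w hw h => ?_⟩
        rw [← hst, Finset.mem_sdiff] at hw
        exact hs hu.1 hw.1 h.ne h
      · ext u
        rw [← hst]
        simp only [Finset.mem_union, Finset.mem_inter, Finset.mem_sdiff, Finset.mem_insert]
        constructor
        · rintro (h | h)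
          exacts [h.1, h.1]
        · intro hu
          by_cases hn : u ∈ G.neighborFinset v
          · exact Or.inr ⟨hu, hn⟩
          · refine Or.inl ⟨hu, ?_⟩
            rintro (rfl | h)
            exacts [hv hu, hn h]
  · rintro (rfl | ⟨A, hA, rfl⟩)
    · constructor
      · intro u hu w hw _ h
        simp only [Finset.coe_insert, Set.mem_insert_iff, Finset.mem_coe] at hu hw
        rcases hu with rfl | hu <;> rcases hw with rfl | hw
        · exact h.ne rfl
        · exact htN _ hw h
        · exact htN _ hu h.symm
        · exact htI _ hu _ hw h
      · ext u
        simp only [Finset.mem_sdiff, Finset.mem_insert, mem_neighborFinset]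
        constructor
        · rintro ⟨rfl | h, h2⟩
          exacts [absurd (Or.inl rfl) h2, h]
        · intro hu
          exact ⟨Or.inr hu, by rintro (rfl | h); exacts [htv hu, htN _ hu h]⟩
    · have hA' : ∀ u ∈ A, u ∈ G.neighborFinset v ∧ ∀ w ∈ t, ¬ G.Adj u w := fun u hu =>
        Finset.mem_filter.1 (hA hu)
      constructor
      · intro u hu w hw _ h
        simp only [Finset.coe_union, Set.mem_union, Finset.mem_coe] at hu hw
        rcases hu with hu | hu <;> rcases hw with hw | hw
        · exact htI _ hu _ hw h
        · exact (hA' _ hw).2 _ hu h.symm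
        · exact (hA' _ hu).2 _ hw h
        · exact hN _ (hA' _ hu).1 _ (hA' _ hw).1 h
      · ext u
        simp only [Finset.mem_sdiff, Finset.mem_insert, Finset.mem_union]
        constructor
        · rintro ⟨h | h, h2⟩
          exacts [h, absurd (Or.inr (hA' _ h).1) h2]
        · intro hu
          refine ⟨Or.inl hu, ?_⟩
          rintro (rfl | h)
          exacts [htv hu, htN _ hu (by simpa using h)]

/-- Among independent sets with the same trace `t` off the closed neighbourhood of `v`, one contains
`v` and scores `D`; the others are `t ∪ A` with `A` an arbitrary subset of the available neighbours
`X`, scoring `|X| / 2` on average. If `X` is small the single set carries the average, otherwise the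
rest do. -/
lemma card_mul_log_le_sum_fiber (hG : G.CliqueFree 3) {D : ℝ} (hD : 1 ≤ D) (v : V)
    {s₀ : Finset V} (hs₀ : G.IsIndepSet s₀) {t : Finset V}
    (ht : s₀ \ insert v (G.neighborFinset v) = t) :
    let C : Finset (Finset V) :=
      {s | G.IsIndepSet s ∧ s \ insert v (G.neighborFinset v) = t}
    (C.card : ℝ) * (Real.log D / 8) ≤
      ∑ s ∈ C, ((if v ∈ s then D else 0) + ((G.neighborFinset v ∩ s).card : ℝ)) := by
  intro C
  set X : Finset V := {u ∈ G.neighborFinset v | ∀ w ∈ t, ¬ G.Adj u w} with hX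
  have htv : v ∉ t := by rw [← ht]; simp
  have hXN : X ⊆ G.neighborFinset v := Finset.filter_subset _ _
  have htN : Disjoint (G.neighborFinset v) t := by
    rw [← ht]
    exact (Finset.disjoint_sdiff (s := insert v (G.neighborFinset v)) (t := s₀)).mono_left
      (Finset.subset_insert _ _)
  have hvX : v ∉ X := fun h => by simpa using hXN h
  have hC : C = insert (insert v t) (X.powerset.image (t ∪ ·)) := by
    apply Finset.coe_injective
    rw [Finset.coe_insert]
    rw [← filter_sdiff_closedNeighborhood_eq G hG v hs₀ ht]
    ext s
    simp [C]
  have hni : insert v t ∉ X.powerset.image (t ∪ ·) := by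
    intro h
    obtain ⟨A, hA, hAt⟩ := Finset.mem_image.1 h
    have : v ∈ t ∪ A := by
      have h1 : v ∈ insert v t := Finset.mem_insert_self _ _
      rw [← hAt] at h1; exact h1
    rcases Finset.mem_union.1 this with h | h
    exacts [htv h, hvX (Finset.mem_powerset.1 hA h)]
  have hinter : ∀ A ∈ X.powerset, G.neighborFinset v ∩ (t ∪ A) = A := by
    intro A hA
    rw [Finset.inter_union_distrib_left, Finset.disjoint_iff_inter_eq_empty.1 htN,
      Finset.empty_union, Finset.inter_eq_right]
    exact (Finset.mem_powerset.1 hA).trans hXN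
  have hinj : Set.InjOn (t ∪ ·) (X.powerset : Set (Finset V)) := by
    intro A hA B hB hAB
    rw [← hinter A hA, ← hinter B hB]
    exact congrArg (G.neighborFinset v ∩ ·) hAB
  rw [hC, Finset.sum_insert hni, Finset.card_insert_of_notMem hni, Finset.card_image_of_injOn hinj,
    Finset.sum_image hinj, Finset.card_powerset]
  have h1 : G.neighborFinset v ∩ insert v t = ∅ := by
    rw [Finset.inter_insert_of_notMem (by simp)]
    exact Finset.disjoint_iff_inter_eq_empty.1 htN
  have h2 : ∑ A ∈ X.powerset, ((if v ∈ t ∪ A then D else 0) +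
      ((G.neighborFinset v ∩ (t ∪ A)).card : ℝ)) = ∑ A ∈ X.powerset, (A.card : ℝ) := by
    refine Finset.sum_congr rfl fun A hA => ?_
    rw [hinter A hA, if_neg, zero_add]
    intro h
    rcases Finset.mem_union.1 h with h | h
    exacts [htv h, hvX (Finset.mem_powerset.1 hA h)]
  rw [h2, h1, if_pos (Finset.mem_insert_self _ _)]
  have h3 := two_mul_sum_card_powerset X
  have h4 := two_pow_add_one_mul_log_le hD X.card
  push_cast
  simp only [Finset.card_empty, Nat.cast_zero, add_zero]
  linarith

/-- **Ajtai–Komlós–Szemerédi** bound `R(3, D) = O(D² / log D)`. -/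
theorem CliqueFree.card_mul_log_le (hG : G.CliqueFree 3) {D : ℝ} (hD : 1 ≤ D)
    (hα : (G.indepNum : ℝ) ≤ D) : (Fintype.card V : ℝ) * Real.log D ≤ 16 * D ^ 2 := by
  set C : Finset (Finset V) := {s | G.IsIndepSet s} with hC
  have hCpos : 0 < (C.card : ℝ) := by
    have : (∅ : Finset V) ∈ C := by simp [hC]
    exact_mod_cast Finset.card_pos.2 ⟨_, this⟩
  -- The score of `s` at `v` is `D · 1[v ∈ s] + |N(v) ∩ s|`. Its mean over a uniform independent set
  -- is bounded below for each `v`, and its sum over `v` is bounded above for each `s`; double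
  -- counting compares the two.
  have hlow : ∀ v : V, (C.card : ℝ) * (Real.log D / 8) ≤
      ∑ s ∈ C, ((if v ∈ s then D else 0) + ((G.neighborFinset v ∩ s).card : ℝ)) := by
    intro v
    set φ : Finset V → Finset V := fun s => s \ insert v (G.neighborFinset v)
    have hmap : ∀ s ∈ C, φ s ∈ C.image φ := fun s hs => Finset.mem_image_of_mem _ hs
    rw [Finset.card_eq_sum_card_fiberwise hmap, ← Finset.sum_fiberwise_of_maps_to hmap,
      Nat.cast_sum, Finset.sum_mul]
    refine Finset.sum_le_sum fun t ht => ?_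
    obtain ⟨s₀, hs₀, hst⟩ := Finset.mem_image.1 ht
    have := card_mul_log_le_sum_fiber G hG hD v (Finset.mem_filter.1 hs₀).2 hst
    simp only [hC, Finset.filter_filter]
    exact this
  have hdeg : ∀ v, ((G.neighborFinset v).card : ℝ) ≤ D := by
    intro v
    refine le_trans ?_ hα
    have := isIndepSet_neighborSet_of_triangleFree G hG v
    have h2 : G.IsIndepSet (G.neighborFinset v : Set V) := by simpa using this
    exact_mod_cast h2.card_le_indepNum
  have hupp : ∀ s ∈ C, ∑ v, ((if v ∈ s then D else 0) + ((G.neighborFinset v ∩ s).card : ℝ)) ≤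
      2 * D ^ 2 := by
    intro s hs
    have hsD : (s.card : ℝ) ≤ D := le_trans (by
      exact_mod_cast (show G.IsIndepSet s from (Finset.mem_filter.1 hs).2).card_le_indepNum) hα
    rw [Finset.sum_add_distrib]
    have h1 : ∑ v, (if v ∈ s then D else 0) = s.card * D := by
      simp
    have h2 : ∑ v, ((G.neighborFinset v ∩ s).card : ℝ) = ∑ u ∈ s, ((G.neighborFinset u).card : ℝ) := by
      have : ∑ v, (G.neighborFinset v ∩ s).card = ∑ u ∈ s, (G.neighborFinset u).card := by
        have := Finset.sum_card_bipartiteAbove_eq_sum_card_bipartiteBelow (fun v u => G.Adj v u)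
          (s := (Finset.univ : Finset V)) (t := s)
        convert this using 3 with v _ u _
        · ext u
          simp [Finset.bipartiteAbove, and_comm]
        · ext w
          simp [Finset.bipartiteBelow, G.adj_comm]
      exact_mod_cast this
    rw [h1, h2]
    have h3 : ∑ u ∈ s, ((G.neighborFinset u).card : ℝ) ≤ s.card * D := by
      rw [← nsmul_eq_mul]
      exact Finset.sum_le_card_nsmul _ _ _ fun u _ => hdeg u
    nlinarith
  have h1 : (Fintype.card V : ℝ) * ((C.card : ℝ) * (Real.log D / 8)) ≤ C.card * (2 * D ^ 2) := by
    calc (Fintype.card V : ℝ) * ((C.card : ℝ) * (Real.log D / 8))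
        = ∑ _v : V, (C.card : ℝ) * (Real.log D / 8) := by simp
      _ ≤ ∑ v, ∑ s ∈ C, ((if v ∈ s then D else 0) + ((G.neighborFinset v ∩ s).card : ℝ)) :=
          Finset.sum_le_sum fun v _ => hlow v
      _ = ∑ s ∈ C, ∑ v, ((if v ∈ s then D else 0) + ((G.neighborFinset v ∩ s).card : ℝ)) :=
          Finset.sum_comm
      _ ≤ C.card * (2 * D ^ 2) := by
          rw [← nsmul_eq_mul]
          exact Finset.sum_le_card_nsmul _ _ _ hupp
  have h2 : (C.card : ℝ) * (Fintype.card V * Real.log D) ≤ C.card * (16 * D ^ 2) := by linarith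
  exact le_of_mul_le_mul_left h2 hCpos

end SimpleGraph

/-! ### Triangles in sets of linear size -/

lemma SimpleGraph.indepNum_comap_le {V W : Type*} [Finite V] [Finite W] (G : SimpleGraph W)
    (f : V ↪ W) : (G.comap f).indepNum ≤ G.indepNum := by
  obtain ⟨s, hs⟩ := (G.comap f).exists_isNIndepSet_indepNum
  rw [← hs.card_eq, ← Finset.card_map f]
  refine SimpleGraph.IsIndepSet.card_le_indepNum ?_
  intro x hx y hy hxy h
  simp only [Finset.coe_map, Set.mem_image, Finset.mem_coe] at hx hy
  obtain ⟨a, ha, rfl⟩ := hx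
  obtain ⟨b, hb, rfl⟩ := hy
  exact hs.isIndepSet ha hb (fun h => hxy (congrArg f h)) h

lemma SimpleGraph.card_mul_log_le_of_cliqueFreeOn {V : Type*} [Finite V] (G : SimpleGraph V)
    {D : ℝ} (hD : 1 ≤ D) (hα : (G.indepNum : ℝ) ≤ D) (W : Finset V) (hW : G.CliqueFreeOn W 3) :
    (W.card : ℝ) * Real.log D ≤ 16 * D ^ 2 := by
  classical
  have h := CliqueFree.card_mul_log_le (G.induce (W : Set V))
    ((cliqueFree_induce_iff _ _ _).2 hW) hD
    (le_trans (by exact_mod_cast indepNum_comap_le G (Function.Embedding.subtype _)) hα)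
  simpa using h

/-- Linear-sized sets contain triangles once the independence number is `o(√(n log n))`. -/
theorem exists_triangle_of_indepNum_le {c : ℝ} (hc : 0 < c) :
    ∃ δ : ℝ, 0 < δ ∧ ∀ᶠ n : ℕ in atTop, ∀ G : SimpleGraph (Fin n),
      (G.indepNum : ℝ) ≤ δ * √(n * Real.log n) → ∀ W : Finset (Fin n), c * n ≤ W.card →
        ∃ s ⊆ W, G.IsNClique 3 s := by
  -- A triangle-free `W` would satisfy `|W| log D ≤ 16 D² = c n log n / 8`, whereas `log D ≥ log n /
  -- 4` makes the left side at least `c n log n / 4`.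
  set δ := √(c / 128) with hδdef
  have hδ : 0 < δ := Real.sqrt_pos.2 (by positivity)
  have hδ2 : δ ^ 2 = c / 128 := Real.sq_sqrt (by positivity)
  refine ⟨δ, hδ, ?_⟩
  have h4 : ∀ᶠ n : ℕ in atTop, 1 / δ ^ 4 ≤ (n : ℝ) :=
    tendsto_natCast_atTop_atTop.eventually_ge_atTop _
  have h5 : ∀ᶠ n : ℕ in atTop, 1 ≤ Real.log (n : ℝ) :=
    (Real.tendsto_log_atTop.comp tendsto_natCast_atTop_atTop).eventually_ge_atTop _
  filter_upwards [h4, h5, eventually_gt_atTop 1] with n hn4 hn1 hn0 G hα W hW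
  by_contra! hcon
  have hnpos : (0 : ℝ) < n := by exact_mod_cast (by omega : 0 < n)
  have hnlog : 0 < n * Real.log n := by positivity
  set D := δ * √(n * Real.log n) with hDdef
  have hD2 : D ^ 2 = δ ^ 2 * (n * Real.log n) := by
    rw [hDdef, mul_pow, Real.sq_sqrt hnlog.le]
  have hα1 : (1 : ℝ) ≤ G.indepNum := by
    have : G.IsIndepSet (({⟨0, by omega⟩} : Finset (Fin n)) : Set (Fin n)) := by
      simp [SimpleGraph.IsIndepSet]
    exact_mod_cast this.card_le_indepNum
  have hDpos : 0 < D := by positivity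
  have hlogD : Real.log n / 4 ≤ Real.log D := by
    have h1 : 1 ≤ δ ^ 4 * n := by
      rw [div_le_iff₀ (by positivity)] at hn4; linarith
    have h2 : (n : ℝ) ≤ D ^ 4 := by
      have : D ^ 4 = δ ^ 4 * n * (n * Real.log n ^ 2) := by
        calc D ^ 4 = (D ^ 2) ^ 2 := by ring
          _ = _ := by rw [hD2]; ring
      rw [this]
      have h3 : (n : ℝ) ≤ n * Real.log n ^ 2 := by
        have : 1 ≤ Real.log n ^ 2 := one_le_pow₀ hn1
        nlinarith
      nlinarith
    have h3 := Real.log_le_log hnpos h2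
    rw [Real.log_pow] at h3
    push_cast at h3
    linarith
  have hmain := G.card_mul_log_le_of_cliqueFreeOn (hα1.trans hα) hα W (by
    intro s hs h
    exact hcon s (by exact_mod_cast hs) h)
  have h6 : c * n * (Real.log n / 4) ≤ W.card * Real.log D :=
    mul_le_mul hW hlogD (by positivity) (by positivity)
  rw [hD2, hδ2] at hmain
  have : 0 < c * (n * Real.log n) := by positivity
  nlinarith

/-! ### Dependent random choice -/

namespace SimpleGraph

/-- Dependent random choice: if every vertex of `X` is related to a `p`-fraction of `Y` and the
independence number is small, then some edge inside `X` has many common relatives in `Y`. -/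
theorem exists_adj_card_common_ge {V β : Type*} [Finite V] (G : SimpleGraph V) (X : Finset V)
    (Y : Finset β) (hY : Y.Nonempty) (r : V → β → Prop) [∀ x, DecidablePred (r x)]
    {p c : ℝ} (hp : 0 ≤ p) (hc : 0 ≤ c) (t : ℕ)
    (hr : ∀ x ∈ X, p * Y.card ≤ (Y.filter (r x)).card)
    (hα : (G.indepNum : ℝ) < X.card * p ^ t - (X.card : ℝ) ^ 2 * c ^ t) :
    ∃ x ∈ X, ∃ y ∈ X, G.Adj x y ∧ c * Y.card ≤ (Y.filter (fun b => r x b ∧ r y b)).card := by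
  classical
  by_contra! hcon
  -- `F` is the space of `t` samples from `Y` with repetition; sums over `F` play the role of
  -- expectations.
  set F : Finset (Fin t → β) := Fintype.piFinset fun _ => Y with hF
  have hFcard : (F.card : ℝ) = (Y.card : ℝ) ^ t := by simp [hF, Fintype.card_piFinset]
  have hYpos : (0 : ℝ) < Y.card := by exact_mod_cast hY.card_pos
  have hFpos : (0 : ℝ) < F.card := by rw [hFcard]; positivity
  have hcount : ∀ q : β → Prop, ∀ _ : DecidablePred q,
      ((F.filter (fun f => ∀ i, q (f i))).card : ℝ) = ((Y.filter q).card : ℝ) ^ t := by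
    intro q _
    have : F.filter (fun f => ∀ i, q (f i)) = Fintype.piFinset fun _ => Y.filter q := by
      ext f
      simp only [hF, Finset.mem_filter, Fintype.mem_piFinset]
      exact forall_and.symm
    rw [this]
    simp [Fintype.card_piFinset]
  set B : Finset (V × V) :=
    (X ×ˢ X).filter fun e => ((Y.filter (fun b => r e.1 b ∧ r e.2 b)).card : ℝ) < c * Y.card
  have hmain : ∀ f ∈ F, ((X.filter fun x => ∀ i, r x (f i)).card : ℝ) ≤ G.indepNum +
      (B.filter fun e => ∀ i, r e.1 (f i) ∧ r e.2 (f i)).card := by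
    intro f _
    set U := X.filter fun x => ∀ i, r x (f i)
    set Bf := B.filter fun e => ∀ i, r e.1 (f i) ∧ r e.2 (f i)
    -- By `hcon` every edge inside `X` is a pair with few common relatives, so deleting one end of
    -- each such pair in `U` destroys all edges.
    have hI : G.IsIndepSet ((U \ Bf.image Prod.fst : Finset V) : Set V) := by
      intro x hx y hy _ hxy
      rw [Finset.mem_coe, Finset.mem_sdiff, Finset.mem_filter] at hx hy
      apply hx.2
      refine Finset.mem_image.2 ⟨(x, y), ?_, rfl⟩
      simp only [Bf, B, Finset.mem_filter, Finset.mem_product]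
      exact ⟨⟨⟨hx.1.1, hy.1.1⟩, hcon x hx.1.1 y hy.1.1 hxy⟩, fun i => ⟨hx.1.2 i, hy.1.2 i⟩⟩
    have h1 := hI.card_le_indepNum
    have h2 := Finset.le_card_sdiff (Bf.image Prod.fst) U
    have h3 : (Bf.image Prod.fst).card ≤ Bf.card := Finset.card_image_le
    have : U.card ≤ G.indepNum + Bf.card := by omega
    exact_mod_cast this
  have hsum := Finset.sum_le_sum hmain
  rw [Finset.sum_add_distrib] at hsum
  have e1 : ∑ f ∈ F, ((X.filter fun x => ∀ i, r x (f i)).card : ℝ) =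
      ∑ x ∈ X, ((F.filter fun f => ∀ i, r x (f i)).card : ℝ) := by
    exact_mod_cast Finset.sum_card_bipartiteAbove_eq_sum_card_bipartiteBelow
      (fun (f : Fin t → β) x => ∀ i, r x (f i))
  have e2 : ∑ f ∈ F, ((B.filter fun e => ∀ i, r e.1 (f i) ∧ r e.2 (f i)).card : ℝ) =
      ∑ e ∈ B, ((F.filter fun f => ∀ i, r e.1 (f i) ∧ r e.2 (f i)).card : ℝ) := by
    exact_mod_cast Finset.sum_card_bipartiteAbove_eq_sum_card_bipartiteBelow
      (fun (f : Fin t → β) (e : V × V) => ∀ i, r e.1 (f i) ∧ r e.2 (f i))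
  have l1 : (X.card : ℝ) * (p ^ t * F.card) ≤
      ∑ x ∈ X, ((F.filter fun f => ∀ i, r x (f i)).card : ℝ) := by
    rw [← nsmul_eq_mul]
    refine Finset.card_nsmul_le_sum _ _ _ fun x hx => ?_
    rw [hcount (r x) inferInstance, hFcard, ← mul_pow]
    exact pow_le_pow_left₀ (by positivity) (hr x hx) t
  have l2 : ∑ e ∈ B, ((F.filter fun f => ∀ i, r e.1 (f i) ∧ r e.2 (f i)).card : ℝ) ≤
      (X.card : ℝ) ^ 2 * (c ^ t * F.card) := by
    have hB : (B.card : ℝ) ≤ (X.card : ℝ) ^ 2 := by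
      have : B.card ≤ X.card * X.card := by
        rw [← Finset.card_product]; exact Finset.card_filter_le _ _
      rw [sq]; exact_mod_cast this
    calc _ ≤ (B.card : ℝ) * (c ^ t * F.card) := by
          rw [← nsmul_eq_mul]
          refine Finset.sum_le_card_nsmul _ _ _ fun e he => ?_
          rw [hcount (fun b => r e.1 b ∧ r e.2 b) inferInstance, hFcard, ← mul_pow]
          exact pow_le_pow_left₀ (by positivity) (Finset.mem_filter.1 he).2.le t
      _ ≤ _ := by gcongr
  rw [e1, e2, Finset.sum_const, nsmul_eq_mul] at hsum
  nlinarith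

/-- Asymptotic form of dependent random choice, for `X` of linear size and independence number
`O(√(n log n))`. The constant `c` does not depend on the relative size `q` of `X`. -/
theorem exists_adj_card_common_ge_of_eventually {p : ℝ} (hp : 0 < p) :
    ∃ c : ℝ, 0 < c ∧ c ≤ 1 ∧ ∀ q : ℝ, 0 < q → ∀ᶠ n : ℕ in atTop, ∀ G : SimpleGraph (Fin n),
      (G.indepNum : ℝ) ≤ √(n * Real.log n) → ∀ X : Finset (Fin n), q * n ≤ X.card →
      ∀ (β : Type) (Y : Finset β), Y.Nonempty → ∀ (r : Fin n → β → Prop)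
        [∀ x, DecidablePred (r x)], (∀ x ∈ X, p * Y.card ≤ (Y.filter (r x)).card) →
      ∃ x ∈ X, ∃ y ∈ X, G.Adj x y ∧
        c * Y.card ≤ (Y.filter (fun b => r x b ∧ r y b)).card := by
  wlog hp1 : p ≤ 1 / 2 generalizing p
  · obtain ⟨c, hc, hc1, h⟩ := this (p := 1 / 2) (by norm_num) le_rfl
    refine ⟨c, hc, hc1, fun q hq => ?_⟩
    filter_upwards [h q hq] with n hn G hα X hX β Y hY r _ hr
    refine hn G hα X hX β Y hY r fun x hx => le_trans ?_ (hr x hx)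
    exact mul_le_mul_of_nonneg_right (by linarith) (Nat.cast_nonneg _)
  obtain ⟨L, hLpos, rfl⟩ : ∃ L : ℝ, 0 < L ∧ p = Real.exp (-L) :=
    ⟨-Real.log p, neg_pos.2 (Real.log_neg hp (by linarith)), by rw [neg_neg, Real.exp_log hp]⟩
  -- With `t ≈ log n / (4 L)` samples, `p ^ t ≥ n ^ (-1/4)`, while `c = p ^ 16` gives `c ^ t = O(n ^
  -- (-4))`. So `|X| p ^ t` has order at least `n ^ (3/4)`, beating `√(n log n)`, and the bad pairs
  -- contribute `O(1)`.
  refine ⟨Real.exp (-L) ^ 16, by positivity, pow_le_one₀ hp.le (by linarith), fun q hq => ?_⟩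
  have hlog : ∀ᶠ n : ℕ in atTop, Real.log n ≤ (q / 2) ^ 2 * (n : ℝ) ^ (1 / 2 : ℝ) := by
    have h := (isLittleO_log_rpow_atTop (r := 1 / 2) (by norm_num)).bound
      (show 0 < (q / 2) ^ 2 by positivity)
    have h2 := tendsto_natCast_atTop_atTop (R := ℝ) |>.eventually h
    filter_upwards [h2] with n hn
    rw [Real.norm_eq_abs, Real.norm_of_nonneg (by positivity)] at hn
    exact (le_abs_self _).trans hn
  have hbig : ∀ᶠ n : ℕ in atTop, 2 * Real.exp (16 * L) / q < (n : ℝ) ^ (3 / 4 : ℝ) :=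
    ((tendsto_rpow_atTop (by norm_num)).comp tendsto_natCast_atTop_atTop).eventually_gt_atTop _
  filter_upwards [hlog, hbig, eventually_gt_atTop 0] with n hnlog hnbig hn0 G hα X hX β Y hY r _ hr
  have hn : (0 : ℝ) < n := by exact_mod_cast hn0
  have hn1 : (1 : ℝ) ≤ n := by exact_mod_cast hn0
  have hlogn : 0 ≤ Real.log n := Real.log_nonneg hn1
  set t := ⌊Real.log n / (4 * L)⌋₊
  have ht1 : L * t ≤ Real.log n / 4 := by
    have : (t : ℝ) ≤ Real.log n / (4 * L) := Nat.floor_le (by positivity)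
    rw [le_div_iff₀ (by positivity)] at this
    linarith
  have ht2 : Real.log n / 4 - L ≤ L * t := by
    have : Real.log n / (4 * L) < t + 1 := Nat.lt_floor_add_one _
    rw [div_lt_iff₀ (by positivity)] at this
    linarith
  have hrp : ∀ a : ℝ, (n : ℝ) ^ a = Real.exp (Real.log n * a) := fun a => Real.rpow_def_of_pos hn a
  have hpt : (n : ℝ) ^ (-(1 / 4) : ℝ) ≤ Real.exp (-L) ^ t := by
    rw [← Real.exp_nat_mul, hrp]
    apply Real.exp_le_exp.2
    nlinarith
  have hct : (Real.exp (-L) ^ 16) ^ t ≤ Real.exp (16 * L) * (n : ℝ) ^ (-4 : ℝ) := by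
    rw [← pow_mul, ← Real.exp_nat_mul, hrp, ← Real.exp_add]
    apply Real.exp_le_exp.2
    push_cast
    nlinarith
  have hXn : (X.card : ℝ) ≤ n := by
    exact_mod_cast (Finset.card_le_univ X).trans (by simp)
  have h1 : q * (n : ℝ) ^ (3 / 4 : ℝ) ≤ X.card * Real.exp (-L) ^ t := by
    calc q * (n : ℝ) ^ (3 / 4 : ℝ) = (q * n) * (n : ℝ) ^ (-(1 / 4) : ℝ) := by
          rw [mul_assoc]
          congr 1
          nth_rw 2 [← Real.rpow_one (n : ℝ)]
          rw [← Real.rpow_add hn]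
          norm_num
      _ ≤ _ := mul_le_mul hX hpt (by positivity) (by positivity)
  have h2 : (X.card : ℝ) ^ 2 * (Real.exp (-L) ^ 16) ^ t ≤ Real.exp (16 * L) := by
    calc (X.card : ℝ) ^ 2 * (Real.exp (-L) ^ 16) ^ t
        ≤ (n : ℝ) ^ 2 * (Real.exp (16 * L) * (n : ℝ) ^ (-4 : ℝ)) := by gcongr
      _ = Real.exp (16 * L) * (n : ℝ) ^ (-2 : ℝ) := by
          rw [← Real.rpow_natCast, mul_left_comm, ← Real.rpow_add hn]
          norm_num
      _ ≤ Real.exp (16 * L) * 1 := by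
          gcongr
          exact Real.rpow_le_one_of_one_le_of_nonpos hn1 (by norm_num)
      _ = _ := mul_one _
  have h3 : √(n * Real.log n) ≤ (q / 2) * (n : ℝ) ^ (3 / 4 : ℝ) := by
    rw [Real.sqrt_le_left (by positivity), mul_pow, ← Real.rpow_natCast ((n : ℝ) ^ (3 / 4 : ℝ)),
      ← Real.rpow_mul hn.le]
    have : (n : ℝ) ^ ((3 / 4 : ℝ) * (2 : ℕ)) = n * (n : ℝ) ^ (1 / 2 : ℝ) := by
      nth_rw 2 [← Real.rpow_one (n : ℝ)]
      rw [← Real.rpow_add hn]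
      norm_num
    rw [this]
    nlinarith
  rw [div_lt_iff₀ hq] at hnbig
  refine exists_adj_card_common_ge G X Y hY r hp.le (by positivity) t hr ?_
  linarith

/-! ### One-sided regularity of pairs -/

/-- All pairs of subsets of `s` and `t` of relative size at least `ε` span edge density at
least `d`. -/
def LowerDense {V : Type*} (G : SimpleGraph V) [DecidableRel G.Adj] (ε d : ℝ)
    (s t : Finset V) : Prop :=
  ∀ s' ⊆ s, ∀ t' ⊆ t, ε * s.card ≤ s'.card → ε * t.card ≤ t'.card →
    d * s'.card * t'.card ≤ (G.interedges s' t').card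

section LowerDense

variable {V : Type*} {G : SimpleGraph V} [DecidableRel G.Adj] {ε d : ℝ} {s t : Finset V}

lemma LowerDense.mono_eps {ε' : ℝ} (h : G.LowerDense ε d s t) (hε : ε ≤ ε') :
    G.LowerDense ε' d s t := fun s' hs' t' ht' h1 h2 =>
  h s' hs' t' ht' (le_trans (by gcongr) h1) (le_trans (by gcongr) h2)

/-- A subset of relative size `ε'` in a `c`-fraction has relative size at least `ε' c` in the whole,
so shrinking costs a factor `1 / c` in the threshold and nothing in the density. -/
lemma LowerDense.subset {ε' c : ℝ} (h : G.LowerDense ε d s t) (hε' : 0 ≤ ε') (hε : ε ≤ ε' * c)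
    {s₁ t₁ : Finset V} (hs : s₁ ⊆ s) (ht : t₁ ⊆ t) (hs' : c * s.card ≤ s₁.card)
    (ht' : c * t.card ≤ t₁.card) : G.LowerDense ε' d s₁ t₁ := by
  intro s' hs1 t' ht1 h1 h2
  refine h s' (hs1.trans hs) t' (ht1.trans ht) (le_trans ?_ h1) (le_trans ?_ h2)
  · calc ε * s.card ≤ ε' * c * s.card := by gcongr
      _ = ε' * (c * s.card) := by ring
      _ ≤ _ := by gcongr
  · calc ε * t.card ≤ ε' * c * t.card := by gcongr
      _ = ε' * (c * t.card) := by ring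
      _ ≤ _ := by gcongr

lemma card_interedges_eq_sum (s t : Finset V) :
    (G.interedges s t).card = ∑ x ∈ s, (t.filter (G.Adj x)).card := by
  classical
  rw [interedges_def, Finset.card_filter, Finset.sum_product]
  exact Finset.sum_congr rfl fun x _ => (Finset.card_filter _ _).symm

/-- More low-degree vertices would form, against all of `t`, a subpair of density below `d`. -/
lemma LowerDense.card_low_degree_le (h : G.LowerDense ε d s t) (hε : 0 ≤ ε) (hε1 : ε ≤ 1) :
    ((s.filter fun x => ((t.filter (G.Adj x)).card : ℝ) < d * t.card).card : ℝ) ≤ ε * s.card := by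
  set b := s.filter fun x => ((t.filter (G.Adj x)).card : ℝ) < d * t.card with hb
  by_contra! hcon
  have hbne : b.Nonempty := by
    rw [← Finset.card_pos]
    have : (0 : ℝ) < b.card := lt_of_le_of_lt (by positivity) hcon
    exact_mod_cast this
  have h1 := h b (Finset.filter_subset _ _) t subset_rfl hcon.le
    (by have : (0 : ℝ) ≤ t.card := Nat.cast_nonneg _
        nlinarith)
  rw [card_interedges_eq_sum] at h1
  push_cast at h1
  have h2 : ∑ x ∈ b, ((t.filter (G.Adj x)).card : ℝ) < ∑ _x ∈ b, d * t.card :=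
    Finset.sum_lt_sum_of_nonempty hbne fun x hx => (Finset.mem_filter.1 hx).2
  rw [Finset.sum_const, nsmul_eq_mul] at h2
  nlinarith

lemma card_high_degree_ge [DecidableEq V] {m : ℕ} {X : Finset V} {Y : Fin m → Finset V}
    (hε : 0 ≤ ε) (hε1 : ε ≤ 1) (h : ∀ j, G.LowerDense ε d X (Y j)) :
    (1 - m * ε) * X.card ≤
      (X.filter fun x => ∀ j, d * (Y j).card ≤ (((Y j).filter (G.Adj x)).card : ℝ)).card := by
  set H := X.filter fun x => ∀ j, d * (Y j).card ≤ (((Y j).filter (G.Adj x)).card : ℝ)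
  set B : Fin m → Finset V :=
    fun j => X.filter fun x => (((Y j).filter (G.Adj x)).card : ℝ) < d * (Y j).card
  have hsub : X ⊆ H ∪ Finset.univ.biUnion B := by
    intro x hx
    by_cases hxH : x ∈ H
    · exact Finset.mem_union_left _ hxH
    · have : ∃ j, (((Y j).filter (G.Adj x)).card : ℝ) < d * (Y j).card := by
        by_contra! hcon
        exact hxH (Finset.mem_filter.2 ⟨hx, hcon⟩)
      obtain ⟨j, hj⟩ := this
      exact Finset.mem_union_right _ (Finset.mem_biUnion.2
        ⟨j, Finset.mem_univ _, Finset.mem_filter.2 ⟨hx, hj⟩⟩)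
  have h1 : (X.card : ℝ) ≤ H.card + ∑ j, ((B j).card : ℝ) := by
    have h3 : X.card ≤ H.card + ∑ j, (B j).card :=
      (Finset.card_le_card hsub).trans ((Finset.card_union_le _ _).trans
        (Nat.add_le_add_left Finset.card_biUnion_le _))
    exact_mod_cast h3
  have h2 : ∑ j, ((B j).card : ℝ) ≤ m * (ε * X.card) := by
    calc ∑ j, ((B j).card : ℝ) ≤ ∑ _j : Fin m, ε * X.card :=
          Finset.sum_le_sum fun j _ => (h j).card_low_degree_le hε hε1
      _ = _ := by simp
  linarith

end LowerDense

/-! ### Cliques in tuples of lower dense sets -/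

/-- An edge inside `X` whose common neighbourhood is linear in each of `m` given sets. -/
theorem exists_adj_common_neighbors (m : ℕ) {d : ℝ} (hd : 0 < d) :
    ∃ c : ℝ, 0 < c ∧ c ≤ 1 ∧ ∀ q : ℝ, 0 < q → ∀ᶠ n : ℕ in atTop, ∀ (G : SimpleGraph (Fin n))
      [DecidableRel G.Adj], (G.indepNum : ℝ) ≤ √(n * Real.log n) →
      ∀ (X : Finset (Fin n)) (Y : Fin m → Finset (Fin n)), q * n ≤ X.card →
      (∀ j, (Y j).Nonempty) → ∀ ε : ℝ, 0 ≤ ε → ε ≤ 1 → m * ε ≤ 1 / 2 →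
      (∀ j, G.LowerDense ε d X (Y j)) →
      ∃ x ∈ X, ∃ y ∈ X, G.Adj x y ∧
        ∀ j, c * (Y j).card ≤ ((Y j).filter fun z => G.Adj x z ∧ G.Adj y z).card := by
  obtain ⟨c, hc, hc1, h⟩ := exists_adj_card_common_ge_of_eventually (p := d ^ m) (by positivity)
  refine ⟨c, hc, hc1, fun q hq => ?_⟩
  filter_upwards [h (q / 2) (by positivity)] with n hn G _ hα X Y hX hY ε hε hε1 hmε hXY
  set H := X.filter fun x => ∀ j, d * (Y j).card ≤ (((Y j).filter (G.Adj x)).card : ℝ) with hH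
  have hHcard : q / 2 * n ≤ H.card := by
    have h1 := card_high_degree_ge hε hε1 hXY
    have h2 : (1 / 2 : ℝ) * X.card ≤ (1 - m * ε) * X.card := by gcongr; linarith
    linarith
  have hYpos : ∀ j, (0 : ℝ) < (Y j).card := fun j => by exact_mod_cast (hY j).card_pos
  have hcount : ∀ (P : Fin n → Prop) [DecidablePred P], ((Fintype.piFinset Y).filter (fun f => ∀ j, P (f j))).card =
      ∏ j, ((Y j).filter P).card := by
    intro P _
    rw [← Fintype.card_piFinset]
    congr 1
    ext f
    simp only [Finset.mem_filter, Fintype.mem_piFinset]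
    exact forall_and.symm
  -- Dependent random choice is run against the product of the `Y j`, a tuple being related to `x`
  -- if all its entries are neighbours. Common relatives then form the product of the common
  -- neighbourhoods; as each factor is at most `|Y i|`, a lower bound on the product bounds every
  -- factor.
  obtain ⟨x, hx, y, hy, hxy, hcom⟩ := hn G hα H hHcard (Fin m → Fin n) (Fintype.piFinset Y)
    (Fintype.piFinset_nonempty.2 hY) (fun x f => ∀ j, G.Adj x (f j)) (by
      intro x hx
      rw [hcount, Fintype.card_piFinset]
      push_cast
      have h1 : d ^ m * ∏ j, ((Y j).card : ℝ) = ∏ j, (d * (Y j).card) := by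
        rw [Finset.prod_mul_distrib]; simp
      rw [h1]
      exact Finset.prod_le_prod (fun j _ => by positivity) fun j _ => (Finset.mem_filter.1 hx).2 j)
  refine ⟨x, (Finset.mem_filter.1 hx).1, y, (Finset.mem_filter.1 hy).1, hxy, fun j => ?_⟩
  have h1 : ((Fintype.piFinset Y).filter (fun f => (∀ j, G.Adj x (f j)) ∧ ∀ j, G.Adj y (f j))).card =
      ∏ j, ((Y j).filter fun z => G.Adj x z ∧ G.Adj y z).card := by
    rw [← hcount fun z => G.Adj x z ∧ G.Adj y z]
    simp only [forall_and]
  rw [h1, Fintype.card_piFinset] at hcom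
  push_cast at hcom
  rw [← Finset.mul_prod_erase _ _ (Finset.mem_univ j),
    ← Finset.mul_prod_erase Finset.univ (fun j => (((Y j).filter _).card : ℝ)) (Finset.mem_univ j),
    ← mul_assoc] at hcom
  have h2 : ∏ j ∈ Finset.univ.erase j, (((Y j).filter fun z => G.Adj x z ∧ G.Adj y z).card : ℝ) ≤
      ∏ j ∈ Finset.univ.erase j, ((Y j).card : ℝ) :=
    Finset.prod_le_prod (fun _ _ => Nat.cast_nonneg _) fun i _ => by
      exact_mod_cast Finset.card_filter_le _ _
  have h3 : 0 < ∏ j ∈ Finset.univ.erase j, ((Y j).card : ℝ) := Finset.prod_pos fun i _ => hYpos i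
  refine le_of_mul_le_mul_right (hcom.trans ?_) h3
  gcongr

lemma IsNClique.insert_adj {V : Type*} [DecidableEq V] {G : SimpleGraph V} {k : ℕ} {s : Finset V}
    (hs : G.IsNClique k s) {x y : V} (hxy : G.Adj x y) (hx : ∀ z ∈ s, G.Adj x z)
    (hy : ∀ z ∈ s, G.Adj y z) : G.IsNClique (k + 2) (insert x (insert y s)) := by
  refine (hs.insert hy).insert fun z hz => ?_
  rcases Finset.mem_insert.1 hz with rfl | hz
  exacts [hxy, hx z hz]

/-- `m` pairwise lower dense sets of linear size contain a clique on `2 * m` vertices. -/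
theorem exists_isNClique_two_mul (m : ℕ) {d : ℝ} (hd : 0 < d) :
    ∃ ε : ℝ, 0 < ε ∧ ∀ q : ℝ, 0 < q → ∀ᶠ n : ℕ in atTop, ∀ (G : SimpleGraph (Fin n))
      [DecidableRel G.Adj], (G.indepNum : ℝ) ≤ √(n * Real.log n) →
      ∀ Y : Fin m → Finset (Fin n), (∀ j, q * n ≤ (Y j).card) →
      (∀ i j, i < j → G.LowerDense ε d (Y i) (Y j)) →
      ∃ s : Finset (Fin n), G.IsNClique (2 * m) s ∧ ∀ v ∈ s, ∃ j, v ∈ Y j := by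
  induction m with
  | zero =>
    refine ⟨1, one_pos, fun q _ => Eventually.of_forall fun n G _ _ Y _ _ => ⟨∅, ?_, by simp⟩⟩
    simp [isNClique_iff]
  | succ m ih =>
    obtain ⟨ε', hε', ih⟩ := ih
    obtain ⟨c, hc, hc1, hedge⟩ := exists_adj_common_neighbors m hd
    -- The first term leaves threshold `ε'` after shrinking by `c`; the second leaves at least half
    -- of `Y 0` with large degree into every other set.
    set ε := min (ε' * c) (1 / (2 * (m + 1))) with hε
    have hεpos : 0 < ε := by positivity
    have hεm : ε * (2 * (m + 1)) ≤ 1 := by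
      rw [← le_div_iff₀ (by positivity)]; exact min_le_right _ _
    have hmpos : (0 : ℝ) ≤ m := Nat.cast_nonneg m
    refine ⟨ε, hεpos, fun q hq => ?_⟩
    filter_upwards [hedge q hq, ih (c * q) (by positivity), eventually_gt_atTop 0]
      with n hn1 hn2 hn0 G _ hα Y hY hYY
    have hn : (0 : ℝ) < n := by exact_mod_cast hn0
    obtain ⟨x, hx, y, hy, hxy, hcom⟩ := hn1 G hα (Y 0) (fun j => Y j.succ) (hY 0)
      (fun j => by
        rw [← Finset.card_pos]
        have : (0 : ℝ) < (Y j.succ).card := lt_of_lt_of_le (by positivity) (hY j.succ)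
        exact_mod_cast this) ε hεpos.le (by nlinarith) (by nlinarith)
      (fun j => hYY 0 j.succ (Fin.succ_pos j))
    obtain ⟨s, hs, hsY⟩ := hn2 G hα
      (fun j => (Y j.succ).filter fun z => G.Adj x z ∧ G.Adj y z)
      (fun j => le_trans (by
        rw [mul_assoc]
        exact mul_le_mul_of_nonneg_left (hY j.succ) hc.le) (hcom j))
      (fun i j hij => (hYY i.succ j.succ (Fin.succ_lt_succ_iff.2 hij)).subset hε'.le
        (min_le_left _ _) (Finset.filter_subset _ _) (Finset.filter_subset _ _) (hcom i) (hcom j))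
    have hadj : ∀ z ∈ s, G.Adj x z ∧ G.Adj y z := fun z hz => by
      obtain ⟨j, hj⟩ := hsY z hz
      exact (Finset.mem_filter.1 hj).2
    refine ⟨insert x (insert y s), hs.insert_adj hxy (fun z hz => (hadj z hz).1)
      (fun z hz => (hadj z hz).2), fun v hv => ?_⟩
    rw [Finset.mem_insert, Finset.mem_insert] at hv
    rcases hv with rfl | rfl | hv
    · exact ⟨0, hx⟩
    · exact ⟨0, hy⟩
    · obtain ⟨j, hj⟩ := hsY v hv
      exact ⟨j.succ, (Finset.mem_filter.1 hj).1⟩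

/-- A pair of linear-sized sets of lower density above `2 / 3` contains a `K₆`. -/
theorem exists_isNClique_six {q : ℝ} (hq : 0 < q) :
    ∃ δ : ℝ, 0 < δ ∧ ∀ᶠ n : ℕ in atTop, ∀ (G : SimpleGraph (Fin n))
      [DecidableRel G.Adj], (G.indepNum : ℝ) ≤ δ * √(n * Real.log n) →
      ∀ A B : Finset (Fin n), q * n ≤ A.card → q * n ≤ B.card →
      G.LowerDense (1 / 2) (69 / 100) A B → ∃ s ⊆ A ∪ B, G.IsNClique 6 s := by
  -- The fraction `1 / 20` serves both triangles: at least half of `A` has high degree, and three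
  -- such vertices share at least `1 - 3 · 0.31 = 0.07` of `B`.
  obtain ⟨δ, hδ, h⟩ := exists_triangle_of_indepNum_le (c := q / 20) (by positivity)
  refine ⟨δ, hδ, ?_⟩
  filter_upwards [h] with n hn G _ hα A B hA hB hAB
  have hnn : (0 : ℝ) ≤ n := Nat.cast_nonneg n
  set H := A.filter fun x => ¬ (((B.filter (G.Adj x)).card : ℝ) < 69 / 100 * B.card) with hH
  have hHcard : q / 20 * n ≤ H.card := by
    have h1 := hAB.card_low_degree_le (by norm_num) (by norm_num)
    have h2 : ((A.filter fun x => ((B.filter (G.Adj x)).card : ℝ) < 69 / 100 * B.card).card : ℝ) +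
        H.card = A.card := by
      exact_mod_cast Finset.card_filter_add_card_filter_not (s := A) _
    nlinarith
  obtain ⟨s, hsH, hs⟩ := hn G hα H hHcard
  set C := B.filter fun z => ∀ x ∈ s, G.Adj x z with hC
  have hsub : B \ C ⊆ s.biUnion fun x => B.filter fun z => ¬ G.Adj x z := by
    intro z hz
    rw [Finset.mem_sdiff, Finset.mem_filter] at hz
    have : ∃ x ∈ s, ¬ G.Adj x z := by
      by_contra! hcon
      exact hz.2 ⟨hz.1, hcon⟩
    obtain ⟨x, hx, hxz⟩ := this
    exact Finset.mem_biUnion.2 ⟨x, hx, Finset.mem_filter.2 ⟨hz.1, hxz⟩⟩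
  have h1 : ((B \ C).card : ℝ) ≤ 3 * (31 / 100 * B.card) := by
    have h3 : ((B \ C).card : ℝ) ≤ ∑ x ∈ s, ((B.filter fun z => ¬ G.Adj x z).card : ℝ) := by
      exact_mod_cast (Finset.card_le_card hsub).trans Finset.card_biUnion_le
    refine h3.trans ?_
    have h4 := Finset.sum_le_card_nsmul s (fun x => ((B.filter fun z => ¬ G.Adj x z).card : ℝ))
      (31 / 100 * B.card) (fun x hx => by
        have h5 := (Finset.mem_filter.1 (hsH hx)).2
        have h6 : ((B.filter (G.Adj x)).card : ℝ) + (B.filter fun z => ¬ G.Adj x z).card =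
            B.card := by
          exact_mod_cast Finset.card_filter_add_card_filter_not (s := B) _
        push Not at h5
        linarith)
    rw [hs.card_eq, nsmul_eq_mul] at h4
    exact_mod_cast h4
  have hCcard : q / 20 * n ≤ C.card := by
    have h2 : ((B \ C).card : ℝ) + C.card = B.card := by
      exact_mod_cast Finset.card_sdiff_add_card_eq_card (Finset.filter_subset _ _)
    nlinarith
  obtain ⟨t, htC, ht⟩ := hn G hα C hCcard
  have hadj : ∀ x ∈ s, ∀ z ∈ t, G.Adj x z := fun x hx z hz => (Finset.mem_filter.1 (htC hz)).2 x hx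
  have hdisj : Disjoint s t := Finset.disjoint_left.2 fun x hx hx' => (hadj x hx x hx').ne rfl
  refine ⟨s ∪ t, Finset.union_subset_union (hsH.trans (Finset.filter_subset _ _))
    (htC.trans (Finset.filter_subset _ _)), ?_, ?_⟩
  · intro x hx y hy hxy
    rw [Finset.coe_union] at hx hy
    rcases hx with hx | hx <;> rcases hy with hy | hy
    · exact hs.isClique hx hy hxy
    · exact hadj x hx y hy
    · exact (hadj y hy x hx).symm
    · exact ht.isClique hx hy hxy
  · rw [Finset.card_union_of_disjoint hdisj, hs.card_eq, ht.card_eq]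

/-- Three pairwise lower dense sets of linear size, one pair of lower density above `2 / 3`,
contain a `K₈`. -/
theorem exists_isNClique_eight {d : ℝ} (hd : 0 < d) :
    ∃ ε : ℝ, 0 < ε ∧ ∀ q : ℝ, 0 < q → ∃ δ : ℝ, 0 < δ ∧ ∀ᶠ n : ℕ in atTop,
      ∀ (G : SimpleGraph (Fin n)) [DecidableRel G.Adj],
      (G.indepNum : ℝ) ≤ δ * √(n * Real.log n) →
      ∀ A B C : Finset (Fin n), q * n ≤ A.card → q * n ≤ B.card → q * n ≤ C.card →
      G.LowerDense ε d A B → G.LowerDense ε d A C → G.LowerDense ε (69 / 100) B C →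
      ∃ s, G.IsNClique 8 s := by
  obtain ⟨c, hc, hc1, hedge⟩ := exists_adj_common_neighbors 2 hd
  -- Two target sets need `2 ε ≤ 1 / 2`, and shrinking by `c` must leave a threshold of at most `1 /
  -- 2`.
  refine ⟨c / 4, by positivity, fun q hq => ?_⟩
  obtain ⟨δ, hδ, h6⟩ := exists_isNClique_six (q := c * q) (by positivity)
  refine ⟨min δ 1, by positivity, ?_⟩
  filter_upwards [hedge q hq, h6, eventually_gt_atTop 0]
    with n hn1 hn2 hn0 G _ hα A B C hA hB hC hAB hAC hBC
  have hn : (0 : ℝ) < n := by exact_mod_cast hn0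
  have hne : ∀ S : Finset (Fin n), q * n ≤ S.card → S.Nonempty := fun S hS => by
    rw [← Finset.card_pos]
    have : (0 : ℝ) < S.card := lt_of_lt_of_le (by positivity) hS
    exact_mod_cast this
  have hs0 : 0 ≤ √(n * Real.log n) := Real.sqrt_nonneg _
  have hα1 : (G.indepNum : ℝ) ≤ √(n * Real.log n) :=
    hα.trans (mul_le_of_le_one_left hs0 (min_le_right _ _))
  have hα2 : (G.indepNum : ℝ) ≤ δ * √(n * Real.log n) :=
    hα.trans (mul_le_mul_of_nonneg_right (min_le_left _ _) hs0)
  obtain ⟨x, hx, y, hy, hxy, hcom⟩ := hn1 G hα1 A ![B, C] hA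
    (by intro j; fin_cases j; exacts [hne B hB, hne C hC]) (c / 4) (by positivity) (by linarith)
    (by push_cast; linarith)
    (by intro j; fin_cases j; exacts [hAB, hAC])
  have hcB := hcom 0
  have hcC := hcom 1
  simp only [Matrix.cons_val_zero, Matrix.cons_val_one] at hcB hcC
  obtain ⟨s, hsub, hs⟩ := hn2 G hα2 (B.filter fun z => G.Adj x z ∧ G.Adj y z)
    (C.filter fun z => G.Adj x z ∧ G.Adj y z)
    (le_trans (by rw [mul_assoc]; gcongr) hcB) (le_trans (by rw [mul_assoc]; gcongr) hcC)
    (hBC.subset (by norm_num) (by linarith) (Finset.filter_subset _ _)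
      (Finset.filter_subset _ _) hcB hcC)
  have hadj : ∀ z ∈ s, G.Adj x z ∧ G.Adj y z := fun z hz => by
    rcases Finset.mem_union.1 (hsub hz) with h | h
    exacts [(Finset.mem_filter.1 h).2, (Finset.mem_filter.1 h).2]
  exact ⟨_, hs.insert_adj hxy (fun z hz => (hadj z hz).1) (fun z hz => (hadj z hz).2)⟩

end SimpleGraph

/-! ### A weighted Turán inequality -/

lemma sum_sum_insert_symm {ι : Type*} [DecidableEq ι] {w : ι → ι → ℝ} (hsymm : ∀ i j, w i j = w j i)
    {T : Finset ι} {a : ι} (ha : a ∉ T) :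
    ∑ i ∈ insert a T, ∑ j ∈ insert a T, w i j =
      ∑ i ∈ T, ∑ j ∈ T, w i j + 2 * ∑ i ∈ T, w i a + w a a := by
  rw [Finset.sum_insert ha, Finset.sum_insert ha,
    Finset.sum_congr rfl fun i _ => Finset.sum_insert ha, Finset.sum_add_distrib,
    Finset.sum_congr rfl fun j _ => hsymm a j]
  ring

/-- A weighted Turán bound: symmetric weights in `[0, 1]` without positive `K₄` whose positive
triangles have weights at most `7 / 10` have average at most `1 / 2`. -/
theorem sum_weights_le {ι : Type*} [DecidableEq ι] (w : ι → ι → ℝ) (hsymm : ∀ i j, w i j = w j i)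
    (h0 : ∀ i j, 0 ≤ w i j) (h1 : ∀ i j, w i j ≤ 1) (S : Finset ι) (hdiag : ∀ i ∈ S, w i i = 0)
    (htri : ∀ a ∈ S, ∀ b ∈ S, ∀ c ∈ S, 0 < w a b → 0 < w a c → 0 < w b c → w b c ≤ 7 / 10)
    (hK4 : ∀ a ∈ S, ∀ b ∈ S, ∀ c ∈ S, ∀ d ∈ S, 0 < w a b → 0 < w a c → 0 < w a d → 0 < w b c →
      0 < w b d → ¬ 0 < w c d) :
    ∑ i ∈ S, ∑ j ∈ S, w i j ≤ (S.card : ℝ) ^ 2 / 2 := by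
  induction S using Finset.strongInduction with
  | H S ih =>
  have hsub : ∀ T ⊂ S, ∑ i ∈ T, ∑ j ∈ T, w i j ≤ (T.card : ℝ) ^ 2 / 2 := by
    intro T hT
    exact ih T hT (fun i hi => hdiag i (hT.1 hi))
      (fun a ha b hb c hc => htri a (hT.1 ha) b (hT.1 hb) c (hT.1 hc))
      (fun a ha b hb c hc d hd => hK4 a (hT.1 ha) b (hT.1 hb) c (hT.1 hc) d (hT.1 hd))
  have hne : ∀ a ∈ S, ∀ b, 0 < w a b → a ≠ b := by
    rintro a ha _ h rfl
    rw [hdiag a ha] at h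
    exact lt_irrefl _ h
  -- Delete a positive triangle if there is one, else a positive edge. An outside vertex sends at
  -- most `14 / 10 ≤ 3 / 2` to the triangle, or at most `1` to the edge; this matches the growth of
  -- `|S|² / 2`.
  by_cases htriangle : ∃ a ∈ S, ∃ b ∈ S, ∃ c ∈ S, 0 < w a b ∧ 0 < w a c ∧ 0 < w b c
  · obtain ⟨a, ha, b, hb, c, hc, hab, hac, hbc⟩ := htriangle
    set T := ((S.erase a).erase b).erase c with hT
    have hcT : c ∉ T := Finset.notMem_erase _ _
    have hbT : b ∉ insert c T := by
      simp only [hT, Finset.mem_insert, Finset.mem_erase]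
      rintro (h | h)
      exacts [hne b hb c hbc h, h.2.1 rfl]
    have haT : a ∉ insert b (insert c T) := by
      simp only [hT, Finset.mem_insert, Finset.mem_erase]
      rintro (h | h | h)
      exacts [hne a ha b hab h, hne a ha c hac h, h.2.2.1 rfl]
    have hS : S = insert a (insert b (insert c T)) := by
      rw [hT, Finset.insert_erase (by simp [hc, (hne a ha c hac).symm, (hne b hb c hbc).symm]),
        Finset.insert_erase (by simp [hb, (hne a ha b hab).symm]), Finset.insert_erase ha]
    have hTS : T ⊂ S := by
      rw [hS]
      exact ((Finset.subset_insert _ _).trans (Finset.subset_insert _ _)).trans_ssubset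
        (Finset.ssubset_insert haT)
    have hcard : (S.card : ℝ) = T.card + 3 := by
      rw [hS, Finset.card_insert_of_notMem haT, Finset.card_insert_of_notMem hbT,
        Finset.card_insert_of_notMem hcT]
      push_cast; ring
    -- Without a positive `K₄`, `v` misses a vertex of the triangle. If it sees both others, these
    -- weights lie in a positive triangle and are at most `7 / 10`; otherwise one weight of at most
    -- `1` remains.
    have hv : ∀ v ∈ T, w v a + w v b + w v c ≤ 14 / 10 := by
      intro v hvT
      have hvS := hTS.1 hvT
      have hpair : ∀ x ∈ S, ∀ y ∈ S, 0 < w x y → w v x + w v y ≤ 14 / 10 := by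
        intro x hx y hy hxy
        rcases (h0 v x).eq_or_lt with h | h
        · linarith [h1 v y]
        rcases (h0 v y).eq_or_lt with h' | h'
        · linarith [h1 v x]
        have e1 := htri x hx v hvS y hy (by rwa [hsymm]) hxy h'
        have e2 := htri y hy v hvS x hx (by rwa [hsymm]) (by rwa [hsymm]) h
        linarith
      rcases (h0 v a).eq_or_lt with h | hva
      · linarith [hpair b hb c hc hbc]
      rcases (h0 v b).eq_or_lt with h | hvb
      · linarith [hpair a ha c hc hac]
      rcases (h0 v c).eq_or_lt with h | hvc
      · linarith [hpair a ha b hb hab]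
      exact absurd hbc (hK4 v hvS a ha b hb c hc hva hvb hvc hab hac)
    have hsum : ∑ v ∈ T, w v a + ∑ v ∈ T, w v b + ∑ v ∈ T, w v c ≤ T.card * (14 / 10) := by
      rw [← Finset.sum_add_distrib, ← Finset.sum_add_distrib, ← nsmul_eq_mul]
      exact Finset.sum_le_card_nsmul _ _ _ hv
    have e1 := htri a ha b hb c hc hab hac hbc
    have e2 := htri b hb a ha c hc (by rwa [hsymm]) hbc hac
    have e3 := htri c hc a ha b hb (by rwa [hsymm]) (by rwa [hsymm]) hab
    have hTsum := hsub T hTS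
    rw [hcard, hS, sum_sum_insert_symm hsymm haT, sum_sum_insert_symm hsymm hbT,
      sum_sum_insert_symm hsymm hcT, Finset.sum_insert hbT, Finset.sum_insert hcT,
      Finset.sum_insert hcT, hdiag a ha, hdiag b hb, hdiag c hc, hsymm b a, hsymm c a, hsymm c b]
    have hTn : (0 : ℝ) ≤ T.card := Nat.cast_nonneg _
    nlinarith
  by_cases hedge : ∃ a ∈ S, ∃ b ∈ S, 0 < w a b
  · obtain ⟨a, ha, b, hb, hab⟩ := hedge
    set T := (S.erase a).erase b with hT
    have hbT : b ∉ T := Finset.notMem_erase _ _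
    have haT : a ∉ insert b T := by
      simp only [hT, Finset.mem_insert, Finset.mem_erase]
      rintro (h | h)
      exacts [hne a ha b hab h, h.2.1 rfl]
    have hS : S = insert a (insert b T) := by
      rw [hT, Finset.insert_erase (by simp [hb, (hne a ha b hab).symm]), Finset.insert_erase ha]
    have hTS : T ⊂ S := by
      rw [hS]
      exact (Finset.subset_insert _ _).trans_ssubset (Finset.ssubset_insert haT)
    have hcard : (S.card : ℝ) = T.card + 2 := by
      rw [hS, Finset.card_insert_of_notMem haT, Finset.card_insert_of_notMem hbT]
      push_cast; ring
    have hsum : ∑ v ∈ T, w v a + ∑ v ∈ T, w v b ≤ T.card * 1 := by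
      rw [← Finset.sum_add_distrib, ← nsmul_eq_mul]
      refine Finset.sum_le_card_nsmul _ _ _ fun v hv => ?_
      rcases (h0 v a).eq_or_lt with h | hva
      · linarith [h1 v b]
      rcases (h0 v b).eq_or_lt with h | hvb
      · linarith [h1 v a]
      exact absurd ⟨v, hTS.1 hv, a, ha, b, hb, hva, hvb, hab⟩ htriangle
    have hTsum := hsub T hTS
    rw [hcard, hS, sum_sum_insert_symm hsymm haT, sum_sum_insert_symm hsymm hbT,
      Finset.sum_insert hbT, hdiag a ha, hdiag b hb, hsymm b a]
    nlinarith [h1 a b]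
  · push Not at hedge
    have : ∑ i ∈ S, ∑ j ∈ S, w i j ≤ 0 :=
      Finset.sum_nonpos fun i hi => Finset.sum_nonpos fun j hj => hedge i hi j hj
    exact this.trans (by positivity)

/-! ### Regularity and the upper bound -/

namespace SimpleGraph

lemma IsUniform.lowerDense {V : Type*} {G : SimpleGraph V} [DecidableRel G.Adj] {ε d : ℝ}
    {s t : Finset V} (h : G.IsUniform ε s t) (hd : d + ε ≤ G.edgeDensity s t) :
    G.LowerDense ε d s t := by
  intro s' hs t' ht h1 h2
  have h3 := (abs_lt.1 (h hs ht (by rwa [mul_comm]) (by rwa [mul_comm]))).1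
  have h4 : d ≤ (G.edgeDensity s' t' : ℝ) := by linarith
  rw [edgeDensity_def] at h4
  push_cast at h4
  rcases (Nat.cast_nonneg (α := ℝ) s'.card).eq_or_lt with h5 | h5
  · simp [← h5]
  rcases (Nat.cast_nonneg (α := ℝ) t'.card).eq_or_lt with h6 | h6
  · simp [← h6]
  rw [le_div_iff₀ (by positivity)] at h4
  linarith

lemma edgeDensity_cast_mul {V : Type*} (H : SimpleGraph V) [DecidableRel H.Adj] (s t : Finset V) :
    (H.edgeDensity s t : ℝ) * (s.card * t.card) = (H.interedges s t).card := by
  rw [edgeDensity_def]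
  push_cast
  rcases (Nat.cast_nonneg (α := ℝ) s.card).eq_or_lt with h5 | h5
  · have : s = ∅ := by simpa using h5.symm
    simp [this]
  rcases (Nat.cast_nonneg (α := ℝ) t.card).eq_or_lt with h6 | h6
  · have : t = ∅ := by simpa using h6.symm
    have h7 : H.interedges s ∅ = ∅ := by ext; simp [mem_interedges_iff]
    simp [this, h7]
  field_simp

section RegularityReduced

variable {V : Type*} [Fintype V] [DecidableEq V] {G : SimpleGraph V} [DecidableRel G.Adj]
  {P : Finpartition (Finset.univ : Finset V)} {ε d : ℝ}

lemma edgeDensity_regularityReduced_le (s t : Finset V) :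
    ((G.regularityReduced P ε d).edgeDensity s t : ℝ) ≤ G.edgeDensity s t := by
  rw [edgeDensity_def, edgeDensity_def]
  push_cast
  gcongr
  intro e he
  rw [mem_interedges_iff] at he ⊢
  exact ⟨he.1, he.2.1, regularityReduced_le he.2.2⟩

/-- One surviving edge suffices: parts are disjoint, so the pair of parts witnessing its survival
must be `(s, t)`. -/
lemma of_edgeDensity_regularityReduced_pos {s t : Finset V} (hs : s ∈ P.parts) (ht : t ∈ P.parts)
    (h : 0 < ((G.regularityReduced P ε d).edgeDensity s t : ℝ)) :
    s ≠ t ∧ G.IsUniform ε s t ∧ d ≤ (G.edgeDensity s t : ℝ) := by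
  have hne : ((G.regularityReduced P ε d).interedges s t).Nonempty := by
    by_contra hcon
    rw [Finset.not_nonempty_iff_eq_empty] at hcon
    rw [edgeDensity_def, hcon] at h
    simp at h
  obtain ⟨⟨x, y⟩, hxy⟩ := hne
  rw [mk_mem_interedges_iff] at hxy
  obtain ⟨hx, hy, -, U, hU, W, hW, hxU, hyW, hUW, hunif, hdens⟩ := hxy
  obtain rfl := P.disjoint.elim hs hU (Finset.not_disjoint_iff.2 ⟨x, hx, hxU⟩)
  obtain rfl := P.disjoint.elim ht hW (Finset.not_disjoint_iff.2 ⟨y, hy, hyW⟩)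
  exact ⟨hUW, hunif, hdens⟩

lemma filter_adj_subset_regularityReduced :
    (Finset.univ : Finset (V × V)).filter (fun e => G.Adj e.1 e.2) ⊆
      (G.regularityReduced P ε d).interedges Finset.univ Finset.univ ∪
      ((P.nonUniforms G ε).biUnion (fun e => e.1 ×ˢ e.2) ∪ P.parts.biUnion Finset.offDiag ∪
        (P.sparsePairs G d).biUnion fun e => G.interedges e.1 e.2) := by
  rintro ⟨x, y⟩ hxy
  have hG : G.Adj x y := (Finset.mem_filter.1 hxy).2
  obtain ⟨U, hU, hx⟩ := P.exists_mem (Finset.mem_univ x)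
  obtain ⟨W, hW, hy⟩ := P.exists_mem (Finset.mem_univ y)
  simp only [Finset.mem_union, Finset.mem_biUnion]
  obtain rfl | hUW := eq_or_ne U W
  · exact Or.inr (Or.inl (Or.inr ⟨U, hU, Finset.mem_offDiag.2 ⟨hx, hy, hG.ne⟩⟩))
  by_cases hunif : G.IsUniform ε U W
  · by_cases hdens : (G.edgeDensity U W : ℝ) < d
    · exact Or.inr (Or.inr ⟨(U, W), (P.mk_mem_sparsePairs G U W d).2 ⟨hU, hW, hUW, hdens⟩,
        G.mk_mem_interedges_iff.2 ⟨hx, hy, hG⟩⟩)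
    · refine Or.inl ?_
      rw [mk_mem_interedges_iff]
      exact ⟨Finset.mem_univ _, Finset.mem_univ _, hG, U, hU, W, hW, hx, hy, hUW, hunif,
        not_lt.1 hdens⟩
  · exact Or.inr (Or.inl (Or.inl ⟨(U, W), (P.mk_mem_nonUniforms G).2 ⟨hU, hW, hUW, hunif⟩,
      Finset.mk_mem_product hx hy⟩))

/-- The three error terms account for irregular pairs of parts, pairs inside one part, and sparse
pairs of parts. -/
lemma card_filter_adj_le_regularityReduced [Nonempty V] {τ : ℝ} (hε : 0 < ε) (hd : 0 ≤ d)
    (hτ : 0 < τ) (hP : P.IsEquipartition) (hunif : P.IsUniform G ε) (hparts : 4 / τ ≤ P.parts.card) :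
    (((Finset.univ : Finset (V × V)).filter fun e => G.Adj e.1 e.2).card : ℝ) ≤
      ((G.regularityReduced P ε d).interedges Finset.univ Finset.univ).card +
        (4 * ε + τ / 2 + 4 * d) * (Fintype.card V : ℝ) ^ 2 := by
  have h2 : (((Finset.univ : Finset (V × V)).filter fun e => G.Adj e.1 e.2).card : ℝ) ≤
      ((G.regularityReduced P ε d).interedges Finset.univ Finset.univ).card +
        (((P.nonUniforms G ε).biUnion (fun e => e.1 ×ˢ e.2)).card +
          (P.parts.biUnion Finset.offDiag).card +
          ((P.sparsePairs G d).biUnion fun e => G.interedges e.1 e.2).card) := by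
    exact_mod_cast (Finset.card_le_card (filter_adj_subset_regularityReduced (P := P))).trans
      ((Finset.card_union_le _ _).trans (Nat.add_le_add_left
        ((Finset.card_union_le _ _).trans (Nat.add_le_add_right (Finset.card_union_le _ _) _)) _))
  have hA := hP.sum_nonUniforms_lt Finset.univ_nonempty hε hunif
  have hB := hP.card_biUnion_offDiag_le hτ hparts
  have hC := hP.card_interedges_sparsePairs_le (G := G) hd
  rw [Finset.card_univ] at hA hB hC
  linarith

lemma _root_.Finpartition.IsEquipartition.card_le_two_mul_card_parts_mul (hP : P.IsEquipartition)
    (hkn : P.parts.card ≤ Fintype.card V) {U : Finset V} (hU : U ∈ P.parts) :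
    (Fintype.card V : ℝ) ≤ 2 * P.parts.card * U.card := by
  set n := Fintype.card V
  set k := P.parts.card
  have h1 : n / k ≤ U.card := by simpa using hP.average_le_card_part hU
  have hk0 : 0 < k := Finset.card_pos.2 ⟨U, hU⟩
  have e1 := Nat.div_add_mod n k
  have e2 := Nat.mod_lt n hk0
  have e3 : 1 ≤ n / k := (Nat.one_le_div_iff hk0).2 hkn
  have h2 : n ≤ 2 * k * (n / k) := by nlinarith
  have : n ≤ 2 * k * U.card := h2.trans (Nat.mul_le_mul_left _ h1)
  exact_mod_cast this

/-- Each part has at most `n / k + 1` vertices, and `k (n / k + 1) = n + k`. -/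
lemma _root_.Finpartition.IsEquipartition.card_interedges_le_of_sum_edgeDensity_le
    (hP : P.IsEquipartition) (R : SimpleGraph V) [DecidableRel R.Adj]
    (hsum : ∑ U ∈ P.parts, ∑ W ∈ P.parts, (R.edgeDensity U W : ℝ) ≤
      (P.parts.card : ℝ) ^ 2 / 2) :
    ((R.interedges Finset.univ Finset.univ).card : ℝ) ≤
      ((Fintype.card V : ℝ) + P.parts.card) ^ 2 / 2 := by
  set n := Fintype.card V
  set k := P.parts.card
  have e1 : (R.interedges Finset.univ Finset.univ).card =
      ∑ e ∈ P.parts ×ˢ P.parts, (R.interedges e.1 e.2).card :=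
    Rel.card_interedges_finpartition R.Adj P P
  rw [e1, Finset.sum_product]
  push_cast
  have hc : ∀ U ∈ P.parts, (U.card : ℝ) ≤ n / k + 1 := by
    intro U hU
    have h1 : U.card ≤ n / k + 1 := by simpa using hP.card_part_le_average_add_one hU
    have h2 : ((n / k : ℕ) : ℝ) ≤ n / k := Nat.cast_div_le
    have h3 : (U.card : ℝ) ≤ ((n / k : ℕ) : ℝ) + 1 := by exact_mod_cast h1
    linarith
  rcases Nat.eq_zero_or_pos k with hk | hk
  · rw [Finset.card_eq_zero.1 hk]
    simp only [Finset.sum_empty]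
    positivity
  calc ∑ U ∈ P.parts, ∑ W ∈ P.parts, ((R.interedges U W).card : ℝ)
      ≤ ∑ U ∈ P.parts, ∑ W ∈ P.parts, (R.edgeDensity U W : ℝ) * ((n : ℝ) / k + 1) ^ 2 := by
        refine Finset.sum_le_sum fun U hU => Finset.sum_le_sum fun W hW => ?_
        rw [← edgeDensity_cast_mul, sq]
        have : (0 : ℝ) ≤ (R.edgeDensity U W : ℝ) := by exact_mod_cast R.edgeDensity_nonneg U W
        exact mul_le_mul_of_nonneg_left (mul_le_mul (hc U hU) (hc W hW) (by positivity)
          (by positivity)) this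
    _ = (∑ U ∈ P.parts, ∑ W ∈ P.parts, (R.edgeDensity U W : ℝ)) * ((n : ℝ) / k + 1) ^ 2 := by
        simp_rw [Finset.sum_mul]
    _ ≤ (k : ℝ) ^ 2 / 2 * ((n : ℝ) / k + 1) ^ 2 := by gcongr
    _ = ((n : ℝ) + k) ^ 2 / 2 := by
        have : (0 : ℝ) < k := by exact_mod_cast hk
        field_simp

end RegularityReduced

open SzemerediRegularity in
-- Ordered pairs are counted, hence `n² / 2`. The order of the constants matters: `ε` depends only
-- on `γ`, the bound `M` on the number of parts depends on `ε` and `γ`, and only then is `δ` chosen,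
-- for parts of relative size `1 / (2 M)`. This is why the thresholds in the clique lemmas may not
-- depend on `q`.
theorem card_filter_adj_le_of_cliqueFree_eight {γ : ℝ} (hγ : 0 < γ) :
    ∃ δ : ℝ, 0 < δ ∧ ∀ᶠ n : ℕ in atTop, ∀ (G : SimpleGraph (Fin n)) [DecidableRel G.Adj],
      G.CliqueFree 8 → (G.indepNum : ℝ) ≤ δ * √(n * Real.log n) →
      (((Finset.univ : Finset (Fin n × Fin n)).filter fun e => G.Adj e.1 e.2).card : ℝ) ≤
        (n : ℝ) ^ 2 / 2 + γ * (n : ℝ) ^ 2 := by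
  set d : ℝ := γ / 32 with hd
  have hdpos : 0 < d := by positivity
  obtain ⟨ε₁, hε₁, h3⟩ := exists_isNClique_eight (d := d / 2) (by positivity)
  obtain ⟨ε₂, hε₂, h4⟩ := exists_isNClique_two_mul 4 (d := d / 2) (by positivity)
  obtain ⟨ε, hε, hεε₁, hεε₂, hεd, hε100⟩ : ∃ ε : ℝ, 0 < ε ∧ ε ≤ ε₁ ∧ ε ≤ ε₂ ∧ ε ≤ d / 2 ∧
      ε ≤ 1 / 100 :=
    ⟨min (min ε₁ ε₂) (min (d / 2) (1 / 100)), by positivity,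
      (min_le_left _ _).trans (min_le_left _ _), (min_le_left _ _).trans (min_le_right _ _),
      (min_le_right _ _).trans (min_le_left _ _), (min_le_right _ _).trans (min_le_right _ _)⟩
  set l : ℕ := ⌈4 / γ⌉₊ with hl
  set M : ℕ := bound ε l with hM
  have hMpos : (0 : ℝ) < M := by exact_mod_cast bound_pos ε l
  obtain ⟨δ, hδ, h3⟩ := h3 (1 / (2 * M)) (by positivity)
  refine ⟨min δ 1, by positivity, ?_⟩
  have hnM : ∀ᶠ n : ℕ in atTop, 8 * M / γ + M ≤ (n : ℝ) :=
    tendsto_natCast_atTop_atTop.eventually_ge_atTop _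
  filter_upwards [h3, h4 (1 / (2 * M)) (by positivity), eventually_ge_atTop l, hnM,
    eventually_gt_atTop 0] with n h3 h4 hnl hnM hn0 G _ hG hα
  have hn : (0 : ℝ) < n := by exact_mod_cast hn0
  have : Nonempty (Fin n) := ⟨⟨0, hn0⟩⟩
  have hs0 : 0 ≤ √(n * Real.log n) := Real.sqrt_nonneg _
  have hα1 : (G.indepNum : ℝ) ≤ √(n * Real.log n) :=
    hα.trans (mul_le_of_le_one_left hs0 (min_le_right _ _))
  have hα2 : (G.indepNum : ℝ) ≤ δ * √(n * Real.log n) :=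
    hα.trans (mul_le_mul_of_nonneg_right (min_le_left _ _) hs0)
  obtain ⟨P, hP, hlP, hPM, hunif⟩ := szemeredi_regularity G hε (l := l) (by simpa using hnl)
  set k := P.parts.card with hk
  have hparts : 4 / γ ≤ k := (Nat.le_ceil _).trans (by exact_mod_cast hlP)
  have hkpos : (0 : ℝ) < k := lt_of_lt_of_le (by positivity) hparts
  have hkM : (k : ℝ) ≤ M := by exact_mod_cast hPM
  have hMn : (M : ℝ) ≤ n := le_trans (by
    have : 0 < 8 * M / γ := by positivity
    linarith) hnM
  have hkn : k ≤ n := by exact_mod_cast hkM.trans hMn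
  have hpart : ∀ U ∈ P.parts, 1 / (2 * M) * (n : ℝ) ≤ U.card := by
    intro U hU
    have h3 := hP.card_le_two_mul_card_parts_mul (by simpa using hkn) hU
    rw [Fintype.card_fin] at h3
    rw [one_div, inv_mul_le_iff₀ (by positivity)]
    exact h3.trans (by gcongr)
  set R := G.regularityReduced P ε d with hR
  set w : Finset (Fin n) → Finset (Fin n) → ℝ := fun U W => (R.edgeDensity U W : ℝ) with hw
  have hLD : ∀ U ∈ P.parts, ∀ W ∈ P.parts, 0 < w U W → G.LowerDense ε (d / 2) U W := by
    intro U hU W hW h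
    obtain ⟨-, hu, hdens⟩ := of_edgeDensity_regularityReduced_pos hU hW h
    exact hu.lowerDense (by linarith)
  have hsum : ∑ U ∈ P.parts, ∑ W ∈ P.parts, w U W ≤ (k : ℝ) ^ 2 / 2 := by
    refine sum_weights_le w (fun U W => ?_) (fun U W => ?_) (fun U W => ?_) P.parts
      (fun U hU => ?_) ?_ ?_
    · simp only [hw]
      rw [edgeDensity_comm]
    · simp only [hw]
      exact_mod_cast R.edgeDensity_nonneg U W
    · simp only [hw]
      exact_mod_cast R.edgeDensity_le_one U W
    · by_contra hne
      have hpos : 0 < w U U := lt_of_le_of_ne (by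
        simp only [hw]; exact_mod_cast R.edgeDensity_nonneg U U) (Ne.symm hne)
      exact (of_edgeDensity_regularityReduced_pos hU hU hpos).1 rfl
    · intro A hA B hB C hC hAB hAC hBC
      by_contra! hcon
      -- The cutoff `7 / 10` exceeds `69 / 100` by the regularity error `ε ≤ 1 / 100`.
      have hBC' : G.LowerDense ε (69 / 100) B C := by
        refine (of_edgeDensity_regularityReduced_pos hB hC hBC).2.1.lowerDense ?_
        have := edgeDensity_regularityReduced_le (G := G) (P := P) (ε := ε) (d := d) B C
        change (7 / 10 : ℝ) < (R.edgeDensity B C : ℝ) at hcon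
        linarith
      obtain ⟨s, hs⟩ := h3 G hα2 A B C (hpart A hA) (hpart B hB) (hpart C hC)
        ((hLD A hA B hB hAB).mono_eps hεε₁) ((hLD A hA C hC hAC).mono_eps hεε₁)
        (hBC'.mono_eps hεε₁)
      exact hG s hs
    · intro A hA B hB C hC D hD hAB hAC hAD hBC hBD hCD
      obtain ⟨s, hs, -⟩ := h4 G hα1 ![A, B, C, D]
        (by intro j; fin_cases j; exacts [hpart A hA, hpart B hB, hpart C hC, hpart D hD])
        (by
          intro i j hij
          fin_cases i <;> fin_cases j <;> first
            | exact absurd hij (by decide)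
            | exact (hLD _ ‹_› _ ‹_› ‹_›).mono_eps hεε₂)
      exact hG s hs
  have hmain := card_filter_adj_le_regularityReduced (G := G) (d := d) hε hdpos.le hγ hP hunif hparts
  have hRsum := hP.card_interedges_le_of_sum_edgeDensity_le R hsum
  rw [Fintype.card_fin] at hRsum
  rw [Fintype.card_fin] at hmain
  have hMγ : M * (n : ℝ) ≤ γ / 8 * (n : ℝ) ^ 2 := by
    have h5 : 8 * M / γ ≤ n := by linarith
    rw [div_le_iff₀ hγ] at h5
    nlinarith
  have hkk : ((n : ℝ) + k) ^ 2 / 2 ≤ (n : ℝ) ^ 2 / 2 + γ / 4 * (n : ℝ) ^ 2 := by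
    have h6 : ((n : ℝ) + k) ^ 2 ≤ (n + M) ^ 2 := by gcongr
    nlinarith
  have hεn : ε * (n : ℝ) ^ 2 ≤ γ / 64 * (n : ℝ) ^ 2 := by
    gcongr
    linarith
  rw [hd] at hmain
  nlinarith [sq_nonneg (n : ℝ)]

end SimpleGraph

/-! ### Counting random functions -/

section RandomFunctions

variable {E α : Type*} [Fintype E] [DecidableEq E] [Fintype α] [DecidableEq α] [Nonempty α]

/-- The number of functions `E → α` sending `T` into `A`. -/
lemma card_filter_forall_mem (T : Finset E) (A : Finset α) :
    ((Finset.univ.filter fun f : E → α => ∀ e ∈ T, f e ∈ A).card : ℝ) =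
      ((A.card : ℝ) / Fintype.card α) ^ T.card * (Fintype.card α : ℝ) ^ Fintype.card E := by
  have h : (Finset.univ.filter fun f : E → α => ∀ e ∈ T, f e ∈ A) =
      Fintype.piFinset fun e => if e ∈ T then A else Finset.univ := by
    ext f
    simp only [Finset.mem_filter, Finset.mem_univ, true_and, Fintype.mem_piFinset]
    refine forall_congr' fun e => ?_
    by_cases he : e ∈ T <;> simp [he]
  have h2 : ∏ e : E, ((if e ∈ T then A else Finset.univ).card : ℝ) =
      (A.card : ℝ) ^ T.card * (Fintype.card α : ℝ) ^ (Tᶜ).card := by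
    have : ∀ e : E, ((if e ∈ T then A else Finset.univ).card : ℝ) =
        if e ∈ T then (A.card : ℝ) else Fintype.card α := by
      intro e; split_ifs <;> simp
    simp_rw [this]
    rw [Finset.prod_ite]
    simp only [Finset.prod_const]
    congr 2
    · congr 1; ext; simp
    · congr 1; ext; simp
  rw [h, Fintype.card_piFinset, Nat.cast_prod, h2]
  have h3 : Fintype.card E = T.card + (Tᶜ).card := (Finset.card_add_card_compl T).symm
  have h4 : (0 : ℝ) < Fintype.card α := by exact_mod_cast Fintype.card_pos
  rw [h3, pow_add, div_pow]
  field_simp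

/-- Few functions take values in `A` at most `M` times on `E₀`. -/
lemma card_filter_card_le (E₀ : Finset E) (A : Finset α) {M : ℕ} (hM : M ≤ E₀.card) :
    ((Finset.univ.filter fun f : E → α => (E₀.filter fun e => f e ∈ A).card ≤ M).card : ℝ) ≤
      E₀.card.choose M * (((Aᶜ).card : ℝ) / Fintype.card α) ^ (E₀.card - M) *
        (Fintype.card α : ℝ) ^ Fintype.card E := by
  have hsub : (Finset.univ.filter fun f : E → α => (E₀.filter fun e => f e ∈ A).card ≤ M) ⊆
      (Finset.powersetCard M E₀).biUnion fun T =>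
        Finset.univ.filter fun f : E → α => ∀ e ∈ E₀ \ T, f e ∈ Aᶜ := by
    intro f hf
    -- Enlarge the set of hits to exactly `M` elements; off it, `f` avoids `A`.
    obtain ⟨T, hT1, hT2, hT3⟩ := Finset.exists_subsuperset_card_eq
      (Finset.filter_subset (fun e => f e ∈ A) E₀) (Finset.mem_filter.1 hf).2 hM
    refine Finset.mem_biUnion.2 ⟨T, Finset.mem_powersetCard.2 ⟨hT2, hT3⟩, ?_⟩
    simp only [Finset.mem_filter, Finset.mem_univ, true_and, Finset.mem_sdiff, Finset.mem_compl]
    exact fun e he h => he.2 (hT1 (Finset.mem_filter.2 ⟨he.1, h⟩))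
  have h1 : ((Finset.univ.filter fun f : E → α =>
      (E₀.filter fun e => f e ∈ A).card ≤ M).card : ℝ) ≤ ∑ T ∈ Finset.powersetCard M E₀,
        ((Finset.univ.filter fun f : E → α => ∀ e ∈ E₀ \ T, f e ∈ Aᶜ).card : ℝ) := by
    exact_mod_cast (Finset.card_le_card hsub).trans Finset.card_biUnion_le
  refine h1.trans (le_of_eq ?_)
  rw [Finset.sum_congr rfl (g := fun _ => (((Aᶜ).card : ℝ) / Fintype.card α) ^ (E₀.card - M) *
        (Fintype.card α : ℝ) ^ Fintype.card E)]
  · simp [Finset.card_powersetCard, mul_assoc]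
  · intro T hT
    rw [Finset.mem_powersetCard] at hT
    rw [card_filter_forall_mem, Finset.card_sdiff_of_subset hT.1, hT.2]

/-- Few functions take values in `A` on all of `ℓ` pairwise disjoint members of a family of
`r`-sets. -/
lemma card_filter_exists_disjoint {ι : Type*} [DecidableEq ι] (𝒬 : Finset ι) (T : ι → Finset E)
    {r : ℕ} (hT : ∀ q ∈ 𝒬, (T q).card = r) (A : Finset α) (ℓ : ℕ)
    [DecidablePred fun f : E → α => ∃ F ∈ Finset.powersetCard ℓ 𝒬,
      (F : Set ι).PairwiseDisjoint T ∧ ∀ q ∈ F, ∀ e ∈ T q, f e ∈ A] :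
    ((Finset.univ.filter fun f : E → α => ∃ F ∈ Finset.powersetCard ℓ 𝒬,
      (F : Set ι).PairwiseDisjoint T ∧ ∀ q ∈ F, ∀ e ∈ T q, f e ∈ A).card : ℝ) ≤
      (𝒬.card.choose ℓ) * ((A.card : ℝ) / Fintype.card α) ^ (r * ℓ) *
        (Fintype.card α : ℝ) ^ Fintype.card E := by
  classical
  set 𝒟 := (Finset.powersetCard ℓ 𝒬).filter fun F : Finset ι => (F : Set ι).PairwiseDisjoint T
  have hsub : (Finset.univ.filter fun f : E → α => ∃ F ∈ Finset.powersetCard ℓ 𝒬,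
      (F : Set ι).PairwiseDisjoint T ∧ ∀ q ∈ F, ∀ e ∈ T q, f e ∈ A) ⊆
      𝒟.biUnion fun F => Finset.univ.filter fun f : E → α => ∀ e ∈ F.biUnion T, f e ∈ A := by
    intro f hf
    obtain ⟨F, hF, hd, hA⟩ := (Finset.mem_filter.1 hf).2
    refine Finset.mem_biUnion.2 ⟨F, Finset.mem_filter.2 ⟨hF, hd⟩, ?_⟩
    simp only [Finset.mem_filter, Finset.mem_univ, true_and, Finset.mem_biUnion]
    rintro e ⟨q, hq, he⟩
    exact hA q hq e he
  have h1 : ((Finset.univ.filter fun f : E → α => ∃ F ∈ Finset.powersetCard ℓ 𝒬,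
      (F : Set ι).PairwiseDisjoint T ∧ ∀ q ∈ F, ∀ e ∈ T q, f e ∈ A).card : ℝ) ≤
      ∑ F ∈ 𝒟, ((Finset.univ.filter fun f : E → α => ∀ e ∈ F.biUnion T, f e ∈ A).card : ℝ) := by
    exact_mod_cast (Finset.card_le_card hsub).trans Finset.card_biUnion_le
  refine h1.trans ?_
  have h2 : ∀ F ∈ 𝒟, ((Finset.univ.filter fun f : E → α =>
      ∀ e ∈ F.biUnion T, f e ∈ A).card : ℝ) ≤ ((A.card : ℝ) / Fintype.card α) ^ (r * ℓ) *
        (Fintype.card α : ℝ) ^ Fintype.card E := by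
    intro F hF
    rw [Finset.mem_filter, Finset.mem_powersetCard] at hF
    rw [card_filter_forall_mem, Finset.card_biUnion (fun x hx y hy hxy => hF.2 hx hy hxy),
      Finset.sum_congr rfl fun q hq => hT q (hF.1.1 hq), Finset.sum_const, hF.1.2, smul_eq_mul,
      mul_comm]
    rw [mul_comm ℓ r, mul_comm]
  refine (Finset.sum_le_card_nsmul _ _ _ h2).trans ?_
  rw [nsmul_eq_mul, mul_assoc]
  refine mul_le_mul_of_nonneg_right ?_ (by positivity)
  rw [← Finset.card_powersetCard]
  exact_mod_cast Finset.card_filter_le _ _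

end RandomFunctions

/-! ### `K₄`-free graphs with small independence number -/

namespace SimpleGraph

variable {V : Type*} [DecidableEq V]

/-- The set of pairs of distinct elements of `S`. -/
def pairsIn (S : Finset V) : Finset (Sym2 V) := S.offDiag.image fun e => s(e.1, e.2)

lemma mk_mem_pairsIn {S : Finset V} {a b : V} : s(a, b) ∈ pairsIn S ↔ a ∈ S ∧ b ∈ S ∧ a ≠ b := by
  simp only [pairsIn, Finset.mem_image, Finset.mem_offDiag, Prod.exists]
  constructor
  · rintro ⟨x, y, ⟨hx, hy, hxy⟩, h⟩
    rcases Sym2.eq_iff.1 h with ⟨rfl, rfl⟩ | ⟨rfl, rfl⟩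
    exacts [⟨hx, hy, hxy⟩, ⟨hy, hx, hxy.symm⟩]
  · intro h
    exact ⟨a, b, h, rfl⟩

lemma card_pairsIn (S : Finset V) : (pairsIn S).card = S.card.choose 2 :=
  Sym2.card_image_offDiag S

variable [Fintype V]

/-- The quadruples meeting `S` in at least two elements. -/
def quadruplesMeeting (S : Finset V) : Finset (Finset V) :=
  (Finset.powersetCard 4 Finset.univ).filter fun Q => 2 ≤ (Q ∩ S).card

/-- Two vertices are chosen in `S`, the other two anywhere. -/
lemma card_quadruplesMeeting_le (S : Finset V) :
    (quadruplesMeeting S).card ≤ S.card ^ 2 * Fintype.card V ^ 2 := by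
  have hsub : quadruplesMeeting S ⊆ ((S ×ˢ S) ×ˢ (Finset.univ ×ˢ Finset.univ)).image
      fun x : (V × V) × (V × V) => {x.1.1, x.1.2, x.2.1, x.2.2} := by
    intro Q hQ
    simp only [quadruplesMeeting, Finset.mem_filter, Finset.mem_powersetCard] at hQ
    obtain ⟨R, hR, hR2⟩ := Finset.exists_subset_card_eq hQ.2
    obtain ⟨a, b, hab, rfl⟩ := Finset.card_eq_two.1 hR2
    have hRQ : ({a, b} : Finset V) ⊆ Q := hR.trans Finset.inter_subset_left
    have h2 : (Q \ {a, b}).card = 2 := by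
      rw [Finset.card_sdiff_of_subset hRQ, hQ.1.2, hR2]
    obtain ⟨c, d, -, hcd⟩ := Finset.card_eq_two.1 h2
    refine Finset.mem_image.2 ⟨((a, b), (c, d)), ?_, ?_⟩
    · simp only [Finset.mem_product, Finset.mem_univ, and_true]
      have := hR.trans Finset.inter_subset_right
      exact ⟨this (by simp), this (by simp)⟩
    · have : ({a, b} : Finset V) ∪ (Q \ {a, b}) = Q := Finset.union_sdiff_of_subset hRQ
      rw [hcd] at this
      rw [← this]
      ext; simp [or_left_comm]
  refine (Finset.card_le_card hsub).trans (Finset.card_image_le.trans ?_)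
  simp [Finset.card_product, sq]

/-- Deleting the edges of a maximal family of edge-disjoint `K₄`s from the graph of zeros of a
function that is quasirandom on all `k`-sets leaves a `K₄`-free graph without independent sets of
size `k`. -/
theorem exists_cliqueFree_four_of_function {α : Type*} (A : Set α) (f : Sym2 V → α) (k ℓ : ℕ)
    [DecidablePred (· ∈ A)]
    (h1 : ∀ S : Finset V, S.card = k → 6 * ℓ < ((pairsIn S).filter fun e => f e ∈ A).card)
    (h2 : ∀ S : Finset V, S.card = k → ¬ ∃ F ∈ Finset.powersetCard ℓ (quadruplesMeeting S),
      (F : Set (Finset V)).PairwiseDisjoint pairsIn ∧ ∀ Q ∈ F, ∀ e ∈ pairsIn Q, f e ∈ A) :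
    ∃ H : SimpleGraph V, H.CliqueFree 4 ∧ H.indepNum < k := by
  classical
  set 𝒞 : Finset (Finset (Finset V)) := Finset.univ.filter fun F =>
    (F : Set (Finset V)).PairwiseDisjoint pairsIn ∧
      ∀ Q ∈ F, Q.card = 4 ∧ ∀ e ∈ pairsIn Q, f e ∈ A with h𝒞
  obtain ⟨F, hF, hmax⟩ := Finset.exists_max_image 𝒞 Finset.card
    ⟨∅, by simp [h𝒞]⟩
  obtain ⟨hdisj, hFQ⟩ := (Finset.mem_filter.1 hF).2
  set D := F.biUnion pairsIn with hD
  set H : SimpleGraph V := SimpleGraph.fromRel fun u v => f s(u, v) ∈ A ∧ s(u, v) ∉ D with hH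
  have hadj : ∀ u v, H.Adj u v ↔ u ≠ v ∧ f s(u, v) ∈ A ∧ s(u, v) ∉ D := by
    intro u v
    rw [hH, SimpleGraph.fromRel_adj, Sym2.eq_swap (a := v), or_self]
  refine ⟨H, ?_, ?_⟩
  · intro Q hQ
    have hQe : ∀ e ∈ pairsIn Q, f e ∈ A ∧ e ∉ D := by
      intro e
      induction e using Sym2.ind with
      | _ a b =>
        intro he
        obtain ⟨ha, hb, hab⟩ := mk_mem_pairsIn.1 he
        exact ((hadj a b).1 (hQ.isClique ha hb hab)).2
    have hQF : Q ∉ F := by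
      intro hQF
      have : (pairsIn Q).Nonempty := by
        rw [← Finset.card_pos, card_pairsIn, hQ.card_eq]
        decide
      obtain ⟨e, he⟩ := this
      exact (hQe e he).2 (Finset.mem_biUnion.2 ⟨Q, hQF, he⟩)
    have : insert Q F ∈ 𝒞 := by
      refine Finset.mem_filter.2 ⟨Finset.mem_univ _, ?_, ?_⟩
      · rw [Finset.coe_insert]
        refine hdisj.insert fun Q' hQ' _ => ?_
        rw [Finset.disjoint_left]
        intro e he he'
        exact (hQe e he).2 (Finset.mem_biUnion.2 ⟨Q', hQ', he'⟩)
      · intro Q' hQ'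
        rcases Finset.mem_insert.1 hQ' with rfl | hQ'
        · exact ⟨hQ.card_eq, fun e he => (hQe e he).1⟩
        · exact hFQ Q' hQ'
    have := hmax _ this
    rw [Finset.card_insert_of_notMem hQF] at this
    omega
  · by_contra! hk
    obtain ⟨I, hI⟩ := H.exists_isNIndepSet_indepNum
    obtain ⟨S, hSI, hS⟩ := Finset.exists_subset_card_eq (hI.card_eq ▸ hk)
    set F' := F.filter fun Q => 2 ≤ (Q ∩ S).card with hF'
    have hsub : ((pairsIn S).filter fun e => f e ∈ A) ⊆ F'.biUnion pairsIn := by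
      intro e
      induction e using Sym2.ind with
      | _ a b =>
        intro he
        obtain ⟨he, hfe⟩ := Finset.mem_filter.1 he
        obtain ⟨ha, hb, hab⟩ := mk_mem_pairsIn.1 he
        have hnadj : ¬ H.Adj a b := hI.isIndepSet (hSI ha) (hSI hb) hab
        rw [hadj] at hnadj
        have heD : s(a, b) ∈ D := by
          by_contra hcon
          exact hnadj ⟨hab, hfe, hcon⟩
        obtain ⟨Q, hQ, heQ⟩ := Finset.mem_biUnion.1 heD
        obtain ⟨haQ, hbQ, -⟩ := mk_mem_pairsIn.1 heQ
        refine Finset.mem_biUnion.2 ⟨Q, Finset.mem_filter.2 ⟨hQ, ?_⟩, heQ⟩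
        rw [← Finset.card_pair hab]
        refine Finset.card_le_card fun x hx => ?_
        rcases Finset.mem_insert.1 hx with rfl | hx
        · exact Finset.mem_inter.2 ⟨haQ, ha⟩
        · rw [Finset.mem_singleton] at hx
          subst hx
          exact Finset.mem_inter.2 ⟨hbQ, hb⟩
    -- In an independent `S` every pair with value in `A` was deleted, so it lies in a member of `F`
    -- meeting `S` twice; each member covers at most six pairs.
    have hcard : ((pairsIn S).filter fun e => f e ∈ A).card ≤ F'.card * 6 := by
      refine (Finset.card_le_card hsub).trans (Finset.card_biUnion_le_card_mul _ _ _ fun Q hQ => ?_)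
      rw [card_pairsIn, (hFQ Q (Finset.mem_filter.1 hQ).1).1]
      decide
    have := h1 S hS
    obtain ⟨F'', hF'', hF''card⟩ := Finset.exists_subset_card_eq (show ℓ ≤ F'.card by omega)
    refine h2 S hS ⟨F'', Finset.mem_powersetCard.2 ⟨fun Q hQ => ?_, hF''card⟩,
      hdisj.subset fun Q hQ => (Finset.mem_filter.1 (hF'' hQ)).1,
      fun Q hQ => (hFQ Q (Finset.mem_filter.1 (hF'' hQ)).1).2⟩
    obtain ⟨hQF, hQS⟩ := Finset.mem_filter.1 (hF'' hQ)
    exact Finset.mem_filter.2 ⟨Finset.mem_powersetCard.2 ⟨Finset.subset_univ _, (hFQ Q hQF).1⟩, hQS⟩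

/-- First moment criterion for the existence of `K₄`-free graphs with small independence number. -/
theorem exists_cliqueFree_four_of_union_bound (k ℓ N : ℕ) (hN : 0 < N)
    (hℓ : 6 * ℓ ≤ k.choose 2)
    (h : ((Fintype.card V).choose k : ℝ) * ((k.choose 2).choose (6 * ℓ) *
        (((N - 1 : ℕ) : ℝ) / N) ^ (k.choose 2 - 6 * ℓ) +
        ((k ^ 2 * Fintype.card V ^ 2).choose ℓ) * (1 / (N : ℝ)) ^ (6 * ℓ)) < 1) :
    ∃ H : SimpleGraph V, H.CliqueFree 4 ∧ H.indepNum < k := by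
  classical
  have : NeZero N := ⟨hN.ne'⟩
  -- Value `0` marks an edge, so a uniform `f` is a random graph of edge probability `1 / N`.
  set A : Finset (Fin N) := {0}
  set Ω : ℝ := (N : ℝ) ^ Fintype.card (Sym2 V) with hΩ
  have hΩpos : 0 < Ω := by positivity
  set bad₁ : Finset V → Finset (Sym2 V → Fin N) := fun S =>
    Finset.univ.filter fun f => ((pairsIn S).filter fun e => f e ∈ A).card ≤ 6 * ℓ
  set bad₂ : Finset V → Finset (Sym2 V → Fin N) := fun S =>
    Finset.univ.filter fun f => ∃ F ∈ Finset.powersetCard ℓ (quadruplesMeeting S),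
      (F : Set (Finset V)).PairwiseDisjoint pairsIn ∧ ∀ Q ∈ F, ∀ e ∈ pairsIn Q, f e ∈ A
  set bad := (Finset.powersetCard k (Finset.univ : Finset V)).biUnion fun S => bad₁ S ∪ bad₂ S
  have hbad : (bad.card : ℝ) < Ω := by
    have h1 : (bad.card : ℝ) ≤ ∑ S ∈ Finset.powersetCard k (Finset.univ : Finset V),
        (((bad₁ S).card : ℝ) + (bad₂ S).card) := by
      exact_mod_cast Finset.card_biUnion_le.trans
        (Finset.sum_le_sum fun S _ => Finset.card_union_le _ _)
    refine h1.trans_lt ?_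
    have h2 : ∀ S ∈ Finset.powersetCard k (Finset.univ : Finset V),
        ((bad₁ S).card : ℝ) + (bad₂ S).card ≤ ((k.choose 2).choose (6 * ℓ) *
        (((N - 1 : ℕ) : ℝ) / N) ^ (k.choose 2 - 6 * ℓ) +
        ((k ^ 2 * Fintype.card V ^ 2).choose ℓ) * (1 / (N : ℝ)) ^ (6 * ℓ)) * Ω := by
      intro S hS
      have hSk : S.card = k := (Finset.mem_powersetCard.1 hS).2
      have hcard : (pairsIn S).card = k.choose 2 := by rw [card_pairsIn, hSk]
      have e1 := card_filter_card_le (pairsIn S) A (M := 6 * ℓ) (by rw [hcard]; exact hℓ)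
      have e2 := card_filter_exists_disjoint (quadruplesMeeting S) pairsIn (r := 6) (by
        intro Q hQ
        rw [card_pairsIn, (Finset.mem_powersetCard.1 (Finset.mem_filter.1 hQ).1).2]
        decide) A ℓ
      rw [hcard, Finset.card_compl, Fintype.card_fin, Finset.card_singleton] at e1
      rw [Fintype.card_fin, Finset.card_singleton, Nat.cast_one] at e2
      have e3 : ((quadruplesMeeting S).card.choose ℓ : ℝ) ≤
          (k ^ 2 * Fintype.card V ^ 2).choose ℓ := by
        have := card_quadruplesMeeting_le S
        rw [hSk] at this
        exact_mod_cast Nat.choose_le_choose ℓ this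
      rw [add_mul]
      refine add_le_add e1 (e2.trans ?_)
      gcongr
    refine (Finset.sum_le_card_nsmul _ _ _ h2).trans_lt ?_
    rw [nsmul_eq_mul, Finset.card_powersetCard, Finset.card_univ, ← mul_assoc]
    exact mul_lt_of_lt_one_left hΩpos h
  have hex : ∃ f : Sym2 V → Fin N, f ∉ bad := by
    by_contra! hcon
    have : bad = Finset.univ := Finset.eq_univ_iff_forall.2 hcon
    rw [this, Finset.card_univ, Fintype.card_fun, Fintype.card_fin] at hbad
    push_cast at hbad
    exact lt_irrefl _ hbad
  obtain ⟨f, hf⟩ := hex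
  have hf' : ∀ S : Finset V, S.card = k → f ∉ bad₁ S ∧ f ∉ bad₂ S := by
    intro S hS
    rw [← not_or, ← Finset.mem_union]
    exact fun hcon => hf (Finset.mem_biUnion.2
      ⟨S, Finset.mem_powersetCard.2 ⟨Finset.subset_univ _, hS⟩, hcon⟩)
  refine exists_cliqueFree_four_of_function (A : Set (Fin N)) f k ℓ (fun S hS => ?_)
    (fun S hS hcon => ?_)
  · have := (hf' S hS).1
    simp only [bad₁, Finset.mem_filter, Finset.mem_univ, true_and, not_le] at this
    simpa using this
  · refine (hf' S hS).2 (Finset.mem_filter.2 ⟨Finset.mem_univ _, ?_⟩)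
    simpa using hcon

lemma natCast_pow_le_exp (t a : ℕ) : ((t : ℝ) ^ a) ≤ Real.exp (t * a) := by
  rw [mul_comm, Real.exp_nat_mul]
  exact pow_le_pow_left₀ (Nat.cast_nonneg t) (by linarith [Real.add_one_le_exp (t : ℝ)]) a

/-- There are `K₄`-free graphs on `t ^ 48` vertices with independence number below `t ^ 24`. -/
theorem exists_cliqueFree_four_indepNum_lt {t : ℕ} (ht : 2000 ≤ t) :
    ∃ H : SimpleGraph (Fin (t ^ 48)), H.CliqueFree 4 ∧ H.indepNum < t ^ 24 := by
  have htR : (2000 : ℝ) ≤ t := by exact_mod_cast ht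
  have ht0 : (0 : ℝ) < t := by linarith
  have ht1 : (1 : ℝ) ≤ t := by linarith
  set K := (t ^ 24).choose 2 with hK
  have hKR : (K : ℝ) = (t : ℝ) ^ 24 * ((t : ℝ) ^ 24 - 1) / 2 := by
    rw [hK, Nat.cast_choose_two]; push_cast; ring
  have h24 : (2000 : ℝ) * t ^ 26 ≤ t ^ 27 := by
    rw [pow_succ (t : ℝ) 26]; nlinarith [pow_pos ht0 26]
  have hp1 : (2000 : ℝ) * t ^ 25 ≤ t ^ 26 := by
    rw [pow_succ (t : ℝ) 25]; nlinarith [pow_pos ht0 25]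
  have hp2 : (2000 : ℝ) * t ^ 27 ≤ t ^ 28 := by
    rw [pow_succ (t : ℝ) 27]; nlinarith [pow_pos ht0 27]
  have hp3 : (2000 : ℝ) * t ^ 24 ≤ t ^ 25 := by
    rw [pow_succ (t : ℝ) 24]; nlinarith [pow_pos ht0 24]
  have hp4 : (t : ℝ) ^ 28 ≤ t ^ 48 := pow_le_pow_right₀ ht1 (by norm_num)
  have hp5 : (1 : ℝ) ≤ t ^ 24 := one_le_pow₀ ht1
  have h48 : (t : ℝ) ^ 24 * t ^ 24 = t ^ 48 := by rw [← pow_add]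
  have hKM : (t : ℝ) ^ 48 / 4 ≤ K - 6 * t ^ 26 := by
    rw [hKR, mul_sub, h48]; nlinarith
  have hℓ : 6 * t ^ 26 ≤ K := by
    have : (6 : ℝ) * t ^ 26 ≤ K := by
      have : (0 : ℝ) ≤ t ^ 48 := by positivity
      linarith
    exact_mod_cast this
  -- For `n = t ^ 48`, `k = t ^ 24`, edge probability `t ^ (-20)`: a `k`-set expects about `t ^ 28 /
  -- 2` edges, and the expected number of `K₄`s meeting it twice is `O(t ^ 24)`. The choice `ℓ = t ^
  -- 26` lies between, and both failure bounds beat the at most `exp (48 t ^ 25)` choices of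
  -- `k`-set.
  refine exists_cliqueFree_four_of_union_bound (t ^ 24) (t ^ 26) (t ^ 20) (by positivity) hℓ ?_
  rw [Fintype.card_fin]
  have hn : ((t ^ 48).choose (t ^ 24) : ℝ) ≤ Real.exp (48 * t ^ 25) := by
    calc ((t ^ 48).choose (t ^ 24) : ℝ) ≤ (t : ℝ) ^ (48 * t ^ 24) := by
          rw [pow_mul]; exact_mod_cast Nat.choose_le_pow _ _
      _ ≤ Real.exp (t * (48 * t ^ 24 : ℕ)) := natCast_pow_le_exp _ _
      _ = _ := by congr 1; push_cast; ring
  have hA1 : (K.choose (6 * t ^ 26) : ℝ) ≤ Real.exp (288 * t ^ 27) := by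
    have hK48 : K ≤ t ^ 48 := by
      have : (K : ℝ) ≤ (t : ℝ) ^ 48 := by rw [hKR, mul_sub, h48]; linarith
      exact_mod_cast this
    calc (K.choose (6 * t ^ 26) : ℝ) ≤ (t : ℝ) ^ (48 * (6 * t ^ 26)) := by
          rw [pow_mul]
          exact_mod_cast (Nat.choose_le_pow _ _).trans (Nat.pow_le_pow_left hK48 _)
      _ ≤ Real.exp (t * (48 * (6 * t ^ 26) : ℕ)) := natCast_pow_le_exp _ _
      _ = _ := by congr 1; push_cast; ring
  have hA2 : (((t ^ 20 - 1 : ℕ) : ℝ) / (t ^ 20 : ℕ)) ^ (K - 6 * t ^ 26) ≤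
      Real.exp (-(t ^ 28 / 4)) := by
    have h20 : (0 : ℝ) < t ^ 20 := by positivity
    have e1 : ((t ^ 20 - 1 : ℕ) : ℝ) / (t ^ 20 : ℕ) ≤ Real.exp (-(1 / t ^ 20)) := by
      rw [Nat.cast_sub (Nat.one_le_pow _ _ (by omega))]
      push_cast
      rw [sub_div, div_self h20.ne']
      linarith [Real.add_one_le_exp (-(1 / (t : ℝ) ^ 20))]
    refine (pow_le_pow_left₀ (by positivity) e1 _).trans ?_
    rw [← Real.exp_nat_mul, Nat.cast_sub hℓ]
    apply Real.exp_le_exp.2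
    push_cast
    have e2 : (t : ℝ) ^ 28 / 4 = t ^ 48 / 4 * (1 / t ^ 20) := by
      field_simp
    rw [e2, mul_neg]
    exact neg_le_neg (mul_le_mul_of_nonneg_right hKM (by positivity))
  have hB : ((((t ^ 24) ^ 2 * (t ^ 48) ^ 2 : ℕ).choose (t ^ 26) : ℕ) : ℝ) *
      (1 / ((t ^ 20 : ℕ) : ℝ)) ^ (6 * t ^ 26) ≤ Real.exp (-(t ^ 26)) := by
    set ℓ := t ^ 26 with hℓdef
    have hℓR : (ℓ : ℝ) = (t : ℝ) ^ 26 := by rw [hℓdef]; push_cast; rfl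
    have hℓpos : (0 : ℝ) < ℓ := by rw [hℓR]; positivity
    have e1 : ((((t ^ 24) ^ 2 * (t ^ 48) ^ 2 : ℕ).choose ℓ : ℕ) : ℝ) ≤
        ((t : ℝ) ^ 144) ^ ℓ / (ℓ.factorial : ℝ) := by
      refine (Nat.choose_le_pow_div ℓ ((t ^ 24) ^ 2 * (t ^ 48) ^ 2)).trans (le_of_eq ?_)
      push_cast; ring
    have e2 : (ℓ : ℝ) ^ ℓ / (ℓ.factorial : ℝ) ≤ Real.exp 1 ^ ℓ := by
      rw [← Real.exp_nat_mul, mul_one]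
      exact Real.pow_div_factorial_le_exp _ hℓpos.le _
    have e3 : ((t : ℝ) ^ 144) ^ ℓ / (ℓ.factorial : ℝ) * (1 / ((t ^ 20 : ℕ) : ℝ)) ^ (6 * ℓ) =
        ((ℓ : ℝ) ^ ℓ / (ℓ.factorial : ℝ)) * (1 / (t : ℝ) ^ 2) ^ ℓ := by
      rw [pow_mul, div_mul_eq_mul_div, div_mul_eq_mul_div, ← mul_pow, ← mul_pow, hℓR]
      congr 2
      push_cast
      field_simp
    have e4 : Real.exp 1 * (1 / (t : ℝ) ^ 2) ≤ Real.exp (-1) := by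
      have h3 := Real.exp_one_lt_d9
      have h4 : Real.exp (-1) * Real.exp 1 = 1 := by rw [← Real.exp_add]; simp
      have h5 : Real.exp 1 * Real.exp 1 ≤ (t : ℝ) ^ 2 := by
        rw [sq]
        exact mul_le_mul (by linarith) (by linarith) (by positivity) (by positivity)
      rw [mul_one_div, div_le_iff₀ (by positivity)]
      calc Real.exp 1 = Real.exp (-1) * (Real.exp 1 * Real.exp 1) := by
            rw [← mul_assoc, h4, one_mul]
        _ ≤ _ := by gcongr
    calc _ ≤ ((t : ℝ) ^ 144) ^ ℓ / (ℓ.factorial : ℝ) * (1 / ((t ^ 20 : ℕ) : ℝ)) ^ (6 * ℓ) := by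
          gcongr
      _ ≤ Real.exp 1 ^ ℓ * (1 / (t : ℝ) ^ 2) ^ ℓ := by rw [e3]; gcongr
      _ ≤ Real.exp (-1) ^ ℓ := by rw [← mul_pow]; gcongr
      _ = _ := by rw [← Real.exp_nat_mul, hℓR]; congr 1; ring
  have hexp1 : Real.exp (-1) < 1 / 2 := by
    have := Real.exp_neg_one_lt_d9
    linarith
  have hfirst : Real.exp (48 * t ^ 25) * (Real.exp (288 * t ^ 27) * Real.exp (-(t ^ 28 / 4))) ≤
      Real.exp (-1) := by
    rw [← Real.exp_add, ← Real.exp_add]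
    apply Real.exp_le_exp.2
    linarith
  have hsecond : Real.exp (48 * t ^ 25) * Real.exp (-(t ^ 26)) ≤ Real.exp (-1) := by
    rw [← Real.exp_add]
    apply Real.exp_le_exp.2
    linarith
  calc _ ≤ Real.exp (48 * t ^ 25) * (Real.exp (288 * t ^ 27) * Real.exp (-(t ^ 28 / 4)) +
          Real.exp (-(t ^ 26))) := by gcongr
    _ < 1 := by rw [mul_add]; linarith

end SimpleGraph

/-! ### The bipartite join and both bounds -/

namespace SimpleGraph

/-- The graph `H` together with all edges between the two classes of `p`. -/
def joinClasses {V : Type*} (H : SimpleGraph V) (p : V → Prop) : SimpleGraph V :=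
  H ⊔ SimpleGraph.fromRel fun u v => p u ∧ ¬ p v

/-- Eight vertices put four in one class, where only edges of `H` are present. -/
lemma CliqueFree.joinClasses {V : Type*} {H : SimpleGraph V} (hH : H.CliqueFree 4) (p : V → Prop) :
    (H.joinClasses p).CliqueFree 8 := by
  classical
  intro s hs
  have key : ∀ q : V → Prop, (∀ u v, q u → q v → (p u ↔ p v)) → ¬ 4 ≤ (s.filter q).card := by
    intro q hq h
    obtain ⟨t, ht, ht4⟩ := Finset.exists_subset_card_eq h
    refine hH t ⟨fun u hu v hv huv => ?_, ht4⟩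
    have hu' := Finset.mem_filter.1 (ht hu)
    have hv' := Finset.mem_filter.1 (ht hv)
    have := hs.isClique hu'.1 hv'.1 huv
    simp only [SimpleGraph.joinClasses, sup_adj, fromRel_adj] at this
    have := hq u v hu'.2 hv'.2
    tauto
  have h1 := key p (fun u v hu hv => by tauto)
  have h2 : ¬ 4 ≤ (s.filter fun v => ¬ p v).card := by
    convert key (fun v => ¬ p v) (fun u v hu hv => by tauto)
  have h3 := Finset.card_filter_add_card_filter_not (s := s) p
  have := hs.card_eq
  omega

lemma indepNum_anti {V : Type*} [Finite V] {G H : SimpleGraph V} (h : H ≤ G) :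
    G.indepNum ≤ H.indepNum := by
  obtain ⟨s, hs⟩ := G.exists_isNIndepSet_indepNum
  rw [← hs.card_eq]
  exact IsIndepSet.card_le_indepNum fun u hu v hv huv huv' => hs.isIndepSet hu hv huv (h huv')

lemma card_filter_adj_eq_two_mul_ncard {V : Type*} [Fintype V] [DecidableEq V]
    (G : SimpleGraph V) [DecidableRel G.Adj] :
    ((Finset.univ : Finset (V × V)).filter fun e => G.Adj e.1 e.2).card = 2 * G.edgeSet.ncard := by
  rw [Set.ncard_eq_toFinset_card']
  exact (two_mul_card_edgeFinset G).symm

lemma le_ncard_edgeSet_joinClasses {V : Type*} [Fintype V] (H : SimpleGraph V) (p : V → Prop)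
    [DecidablePred p] :
    (Finset.univ.filter p).card * (Finset.univ.filter fun v => ¬ p v).card ≤
      (H.joinClasses p).edgeSet.ncard := by
  classical
  have h := card_filter_adj_eq_two_mul_ncard (H.joinClasses p)
  set A := Finset.univ.filter p
  set B := Finset.univ.filter fun v => ¬ p v
  have hdisj : Disjoint (A ×ˢ B) (B ×ˢ A) := by
    rw [Finset.disjoint_left]
    rintro ⟨u, v⟩ h1 h2
    rw [Finset.mem_product] at h1 h2
    exact (Finset.mem_filter.1 h2.1).2 (Finset.mem_filter.1 h1.1).2
  have hsub : A ×ˢ B ∪ B ×ˢ A ⊆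
      (Finset.univ : Finset (V × V)).filter fun e => (H.joinClasses p).Adj e.1 e.2 := by
    rintro ⟨u, v⟩ huv
    simp only [A, B, Finset.mem_union, Finset.mem_product, Finset.mem_filter, Finset.mem_univ,
      true_and] at huv ⊢
    simp only [joinClasses, sup_adj, fromRel_adj]
    refine Or.inr ⟨?_, by tauto⟩
    rintro rfl
    tauto
  have h2 := Finset.card_le_card hsub
  rw [Finset.card_union_of_disjoint hdisj, Finset.card_product, Finset.card_product, h,
    mul_comm B.card] at h2
  omega

lemma ncard_edgeSet_le_of_cliqueFree_eight {γ : ℝ} (hγ : 0 < γ) :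
    ∃ δ : ℝ, 0 < δ ∧ ∀ (n : ℕ) (G : SimpleGraph (Fin n)), G.CliqueFree 8 →
      (G.indepNum : ℝ) ≤ δ * √((n : ℝ) * Real.log (n : ℝ)) →
      (G.edgeSet.ncard : ℝ) ≤ (n : ℝ) ^ 2 / 4 + γ * (n : ℝ) ^ 2 := by
  classical
  obtain ⟨δ, hδ, h⟩ := card_filter_adj_le_of_cliqueFree_eight hγ
  obtain ⟨n₀, h⟩ := eventually_atTop.1 h
  -- For `0 < n < n₀` the term `1 / (n₀ + 1)` forces `α < 1`, so no such graph exists and the bound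
  -- extends to every `n`.
  refine ⟨min δ (1 / (n₀ + 1)), by positivity, fun n G hG hα => ?_⟩
  have hs0 : 0 ≤ √(n * Real.log n) := Real.sqrt_nonneg _
  have hcount := card_filter_adj_eq_two_mul_ncard G
  rcases Nat.eq_zero_or_pos n with rfl | hn0
  · have : G.edgeSet.ncard = 0 := by
      have h0 : ((Finset.univ : Finset (Fin 0 × Fin 0)).filter fun e => G.Adj e.1 e.2).card = 0 := by
        simp
      omega
    simp [this]
  rcases le_or_gt n₀ n with hn | hn
  · have h1 := h n hn G hG (hα.trans (mul_le_mul_of_nonneg_right (min_le_left _ _) hs0))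
    rw [hcount] at h1
    push_cast at h1
    have : 0 ≤ γ * (n : ℝ) ^ 2 := by positivity
    linarith
  · exfalso
    have hα1 : (1 : ℝ) ≤ G.indepNum := by
      have : G.IsIndepSet (({⟨0, hn0⟩} : Finset (Fin n)) : Set (Fin n)) := by
        simp [IsIndepSet]
      exact_mod_cast this.card_le_indepNum
    have hnR : (0 : ℝ) < n := by exact_mod_cast hn0
    have h1 : √(n * Real.log n) ≤ n := by
      rw [Real.sqrt_le_left hnR.le, sq]
      have := Real.log_le_sub_one_of_pos hnR
      gcongr
      linarith
    have h2 : (n : ℝ) < n₀ + 1 := by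
      have : (n : ℝ) < n₀ := by exact_mod_cast hn
      linarith
    have h3 : (1 : ℝ) ≤ 1 / (n₀ + 1) * n := by
      refine hα1.trans (hα.trans (mul_le_mul (min_le_right _ _) h1 hs0 (by positivity)))
    rw [one_div, ← div_eq_inv_mul, le_div_iff₀ (by positivity)] at h3
    linarith

lemma exists_cliqueFree_four_indepNum_le {δ : ℝ} (hδ : 0 < δ) :
    ∀ᶠ n : ℕ in atTop, ∃ H : SimpleGraph (Fin n), H.CliqueFree 4 ∧
      (H.indepNum : ℝ) ≤ δ * √((n : ℝ) * Real.log (n : ℝ)) := by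
  have hlog : ∀ᶠ n : ℕ in atTop, (2 ^ 24 / δ) ^ 2 ≤ Real.log (n : ℝ) :=
    (Real.tendsto_log_atTop.comp tendsto_natCast_atTop_atTop).eventually_ge_atTop _
  filter_upwards [hlog, eventually_gt_atTop (2000 ^ 48)] with n hn hn2
  have hex : ∃ t : ℕ, n ≤ t ^ 48 := ⟨n, Nat.le_self_pow (by norm_num) n⟩
  -- Minimality gives `(t - 1) ^ 48 < n`, so restricting to `n` vertices leaves independence number
  -- at most `2 ^ 24 √n`; the factor `√(log n)` absorbs `2 ^ 24 / δ`.
  set t := Nat.find hex with ht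
  have ht1 : n ≤ t ^ 48 := Nat.find_spec hex
  have ht2 : 2000 < t := lt_of_pow_lt_pow_left₀ 48 (Nat.zero_le _) (hn2.trans_le ht1)
  have ht3 : (t - 1) ^ 48 < n := not_le.1 (Nat.find_min hex (by omega))
  obtain ⟨H, hH, hHα⟩ := exists_cliqueFree_four_indepNum_lt ht2.le
  set f : Fin n ↪ Fin (t ^ 48) := (Fin.castLEEmb ht1)
  refine ⟨H.comap f, hH.comap (Embedding.comap f H).isContained, ?_⟩
  have h1 : ((H.comap f).indepNum : ℝ) ≤ (t : ℝ) ^ 24 := by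
    exact_mod_cast (indepNum_comap_le H f).trans hHα.le
  have h2 : (t : ℝ) ^ 24 ≤ 2 ^ 24 * √n := by
    have h3 : t ≤ 2 * (t - 1) := by omega
    have h4 : (t : ℝ) ^ 24 ≤ 2 ^ 24 * ((t - 1 : ℕ) : ℝ) ^ 24 := by
      rw [← mul_pow]
      exact_mod_cast Nat.pow_le_pow_left h3 24
    have h5 : ((t - 1 : ℕ) : ℝ) ^ 24 ≤ √n := by
      apply Real.le_sqrt_of_sq_le
      rw [← pow_mul]
      exact_mod_cast ht3.le
    linarith
  have h6 : 2 ^ 24 / δ ≤ √(Real.log n) := Real.le_sqrt_of_sq_le hn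
  rw [div_le_iff₀ hδ] at h6
  rw [Real.sqrt_mul (Nat.cast_nonneg n)]
  nlinarith [Real.sqrt_nonneg (n : ℝ)]

lemma exists_cliqueFree_eight_ncard_edgeSet_ge {δ : ℝ} (hδ : 0 < δ) :
    ∀ᶠ n : ℕ in atTop, ∃ G : SimpleGraph (Fin n), G.CliqueFree 8 ∧
      (G.indepNum : ℝ) ≤ δ * √((n : ℝ) * Real.log (n : ℝ)) ∧
      ((n : ℝ) ^ 2 - 1) / 4 ≤ G.edgeSet.ncard := by
  filter_upwards [exists_cliqueFree_four_indepNum_le hδ] with n hn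
  obtain ⟨H, hH, hα⟩ := hn
  set p : Fin n → Prop := fun v => (v : ℕ) < n / 2
  refine ⟨H.joinClasses p, hH.joinClasses p, le_trans ?_ hα, ?_⟩
  · exact_mod_cast indepNum_anti (le_sup_left : H ≤ H.joinClasses p)
  have h1 := le_ncard_edgeSet_joinClasses H p
  have h2 : (Finset.univ.filter p).card = n / 2 := by
    simp only [p, Fin.card_filter_val_lt]
    omega
  have h3 := Finset.card_filter_add_card_filter_not (s := (Finset.univ : Finset (Fin n))) p
  rw [Finset.card_univ, Fintype.card_fin] at h3
  have h4 : n ^ 2 ≤ 4 * ((Finset.univ.filter p).card *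
      (Finset.univ.filter fun v => ¬ p v).card) + 1 := by
    set b := (Finset.univ.filter fun v => ¬ p v).card
    rw [h2] at h3 ⊢
    have h5 : b = n / 2 ∨ b = n / 2 + 1 := by omega
    rcases h5 with h5 | h5 <;> rw [h5] at h3 ⊢ <;> nlinarith
  have h6 : (n : ℝ) ^ 2 ≤ 4 * ((H.joinClasses p).edgeSet.ncard : ℝ) + 1 := by
    exact_mod_cast h4.trans (by omega)
  linarith

end SimpleGraph

theorem theorem1p3 :
    (∀ γ : ℝ, 0 < γ → ∃ δ : ℝ, 0 < δ ∧
      ∀ (n : ℕ) (G : SimpleGraph (Fin n)), G.CliqueFree 8 →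
        (G.indepNum : ℝ) ≤ δ * Real.sqrt ((n : ℝ) * Real.log (n : ℝ)) →
        (G.edgeSet.ncard : ℝ) ≤ (n : ℝ) ^ 2 / 4 + γ * (n : ℝ) ^ 2) ∧
    RamseyTuranLittleO (SimpleGraph.completeGraph (Fin 8))
      (fun n : ℕ => Real.sqrt ((n : ℝ) * Real.log (n : ℝ))) (1 / 4) := by
  refine ⟨fun γ hγ => SimpleGraph.ncard_edgeSet_le_of_cliqueFree_eight hγ, fun ε hε => ?_⟩
  obtain ⟨δ₀, hδ₀, hupper⟩ := SimpleGraph.ncard_edgeSet_le_of_cliqueFree_eight hε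
  refine ⟨δ₀, hδ₀, fun δ hδ hδδ₀ => ?_⟩
  -- Needed only to absorb the parity loss of `1 / 4` in the lower bound.
  have hbig : ∀ᶠ n : ℕ in atTop, 1 / ε ≤ (n : ℝ) :=
    tendsto_natCast_atTop_atTop.eventually_ge_atTop _
  filter_upwards [SimpleGraph.exists_cliqueFree_eight_ncard_edgeSet_ge hδ, hbig,
    eventually_ge_atTop 1] with n hlower hn hn1
  have hfree : ∀ G : SimpleGraph (Fin n),
      (SimpleGraph.completeGraph (Fin 8)).Free G ↔ G.CliqueFree 8 := fun G => by
    simpa using (SimpleGraph.cliqueFree_iff_top_free (G := G) (β := Fin 8)).symm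
  have hle : ∀ e ∈ {e : ℕ | ∃ G : SimpleGraph (Fin n),
      (SimpleGraph.completeGraph (Fin 8)).Free G ∧
      (G.indepNum : ℝ) ≤ δ * √((n : ℝ) * Real.log (n : ℝ)) ∧ G.edgeSet.ncard = e},
      (e : ℝ) ≤ (n : ℝ) ^ 2 / 4 + ε * (n : ℝ) ^ 2 := by
    rintro e ⟨G, hG, hα, rfl⟩
    exact hupper n G ((hfree G).1 hG)
      (hα.trans (mul_le_mul_of_nonneg_right hδδ₀ (Real.sqrt_nonneg _)))
  obtain ⟨G, hG, hα, hGe⟩ := hlower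
  have hmem : G.edgeSet.ncard ∈ {e : ℕ | ∃ G : SimpleGraph (Fin n),
      (SimpleGraph.completeGraph (Fin 8)).Free G ∧
      (G.indepNum : ℝ) ≤ δ * √((n : ℝ) * Real.log (n : ℝ)) ∧ G.edgeSet.ncard = e} :=
    ⟨G, (hfree G).2 hG, hα, rfl⟩
  have hbdd : BddAbove {e : ℕ | ∃ G : SimpleGraph (Fin n),
      (SimpleGraph.completeGraph (Fin 8)).Free G ∧
      (G.indepNum : ℝ) ≤ δ * √((n : ℝ) * Real.log (n : ℝ)) ∧ G.edgeSet.ncard = e} :=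
    ⟨⌊(n : ℝ) ^ 2 / 4 + ε * (n : ℝ) ^ 2⌋₊, fun e he => Nat.le_floor (hle e he)⟩
  have h1 : (ramseyTuran n (SimpleGraph.completeGraph (Fin 8))
      (δ * √((n : ℝ) * Real.log (n : ℝ))) : ℝ) ≤ (n : ℝ) ^ 2 / 4 + ε * (n : ℝ) ^ 2 :=
    hle _ (Nat.sSup_mem ⟨_, hmem⟩ hbdd)
  have h2 : (G.edgeSet.ncard : ℝ) ≤ ramseyTuran n (SimpleGraph.completeGraph (Fin 8))
      (δ * √((n : ℝ) * Real.log (n : ℝ))) := by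
    exact_mod_cast le_csSup hbdd hmem
  have h3 : 1 ≤ ε * (n : ℝ) ^ 2 := by
    rw [div_le_iff₀ hε] at hn
    have : (1 : ℝ) ≤ n := by exact_mod_cast hn1
    nlinarith
  rw [abs_le]
  constructor <;> linarith
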